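/- Let $a,b\in C^0([0,1])$ be real functions with $b/a\in L^1(0,1)$, $a(0)=0$ and $a>0$ on $(0,1]$, and suppose that for some $K>0$ the function $x\mapsto x^K/a(x)$ is nondecreasing in a right neighbourhood of $0$. Let $\beta\ge 0$, and put $$\eta(x)=\exp\Big(\int_{1/2}^x\frac{b(s)}{a(s)}\,ds\Big),\qquad \sigma=\frac a\eta ,\qquad Au=au''+bu'=\sigma(\eta u')' .$$ Consider the problem $$y_{tt}-a\,y_{xx}-b\,y_x=0 \ \text{ for } t>0,\ x\in(0,1),\qquad y_t(t,1)+\eta(1) y_x(t,1)+\beta y(t,1)=0,\qquad y(t,0)=0,\qquad y(0)=y_0,\ y_t(0)=y_1. \tag{W}$$ Spaces. $L^2_{1/\sigma}$ is the space of functions on $(0,1)$ with $\|u\|_{1/\sigma}^2=\int_0^1u^2/\sigma\,dx<\infty$. $H^1_{1/\sigma,0}$ is the space of $u\in L^2_{1/\sigma}\cap H^1(0,1)$ with $u(0)=0$, normed by $\|u\|_{H^1}^2=\|u\|_{1/\sigma}^2+\int_0^1(u')^2dx$. $H^2_{1/\sigma,0}$ is the space of $u\in H^1_{1/\sigma,0}$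 for which $\eta u'$ is locally absolutely continuous on $(0,1]$ and $Au\in L^2_{1/\sigma}$, normed by $\|u\|_{H^2}^2=\|u\|_{H^1}^2+\|Au\|_{1/\sigma}^2$. Let $\mathcal H_0=H^1_{1/\sigma,0}\times L^2_{1/\sigma}$, and $$\|(u,v)\|_{\mathcal H_0}^2=\int_0^1(u')^2dx+\int_0^1\frac{v^2}{\sigma}dx+\beta u(1)^2 ,\qquad \|(u,v)\|_{H^1\times L^2}=\max\{\|u\|_{H^1},\|v\|_{1/\sigma}\}.$$ Let $\mathcal A(u,v)=(v,Au)$ with domain $D(\mathcal A)=\{(u,v)\in H^2_{1/\sigma,0}\times H^1_{1/\sigma,0}:(\eta u')(1)+v(1)+\beta u(1)=0\}$. A mild solution of (W) with data $(y_0,y_1)\in\mathcal H_0$ is a function $y:[0,\infty)\to H^1_{1/\sigma,0}$ such that $Y=(y,y_t)$ is continuous from $[0,\infty)$ to $H^1_{1/\sigma,0}\times L^2_{1/\sigma}$ (with $y_t$ the derivative in $L^2_{1/\sigma}$) and, for all $t\ge0$, $\int_0^tY(s)\,ds\in D(\mathcal A)$ and $Y(t)=(y_0,y_1)+\mathcal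 A\int_0^tY(s)\,ds$. Theorem. 1. For every $(y_0,y_1)\in\mathcal H_0$ there is exactly one mild solution $y$ of (W). It belongs to $C^1([0,\infty);L^2_{1/\sigma})\cap C([0,\infty);H^1_{1/\sigma,0})$ and satisfies $y(0)=y_0$, $y_t(0)=y_1$. 2. The solution depends continuously on the data. If $y,z$ are the mild solutions with data $Y_0,Z_0\in\mathcal H_0$, and $Y=(y,y_t)$, $Z=(z,z_t)$, then, with constants $C$ and $C_T$ independent of $Y_0,Z_0$, $$\|Y(t)-Z(t)\|_{\mathcal H_0}\le C\|Y_0-Z_0\|_{\mathcal H_0}\quad(t\ge0),\qquad \|Y(t)-Z(t)\|_{H^1\times L^2}\le C_T\|Y_0-Z_0\|_{H^1\times L^2}\quad(0\le t\le T),$$ for every $T$, and if $K\le2$ then also, with $C$ independent of $Y_0,Z_0$, $$\|Y(t)-Z(t)\|_{H^1\times L^2}\le C\|Y_0-Z_0\|_{\mathcal H_0}\quad(t\ge0).$$ 3. If $(y_0,y_1)\in D(\mathcal A)$, then the mild solution is classical: $y\in C^2([0,\infty);L^2_{1/\sigma})\cap C^1([0,\infty);H^1_{1/\sigma,0})\cap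 C([0,\infty);H^2_{1/\sigma,0})$, and for every $t\ge0$ one has $y_{tt}(t)=Ay(t)$ in $L^2_{1/\sigma}$, that is, $y_{tt}=a\,y_{xx}+b\,y_x$ for a.e. $x\in(0,1)$ (with $y_x(t,\cdot)$ locally absolutely continuous on $(0,1]$), and $y_t(t,1)+\eta(1)y_x(t,1)+\beta y(t,1)=0$, $y(t,0)=0$. -/

import Mathlib

open MeasureTheory Set Filter Topology

namespace DegenerateWave

noncomputable section

/-- The coefficients: `a, b ∈ C⁰[0,1]`, `b / a ∈ L¹(0,1)`, `a(0) = 0`, `a > 0` on `(0,1]`, and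
`x ↦ x ^ K / a x` is nondecreasing in a right neighbourhood of `0`, where `K > 0`. -/
structure CoeffHyp (a b : ℝ → ℝ) (K : ℝ) : Prop where
  continuousOn_a : ContinuousOn a (Icc 0 1)
  continuousOn_b : ContinuousOn b (Icc 0 1)
  integrable_div : IntegrableOn (fun x => b x / a x) (Ioo 0 1) volume
  a_zero : a 0 = 0
  a_pos : ∀ x ∈ Ioc (0 : ℝ) 1, 0 < a x
  K_pos : 0 < K
  monotone_near_zero : ∃ δ ∈ Ioc (0 : ℝ) 1, MonotoneOn (fun x => x ^ K / a x) (Ioo 0 δ)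

/-- The weight `η(x) = exp (∫_{1/2}^x b/a)`. -/
def eta (a b : ℝ → ℝ) (x : ℝ) : ℝ := Real.exp (∫ s in (1 / 2 : ℝ)..x, b s / a s)

/-- `σ = a / η`. -/
def sigma (a b : ℝ → ℝ) (x : ℝ) : ℝ := a x / eta a b x

/-- Lebesgue measure on `(0,1)`. -/
abbrev unitMeasure : Measure ℝ := volume.restrict (Ioo (0 : ℝ) 1)

/-- The measure `dx / σ` on `(0,1)`. -/
def weightMeasure (a b : ℝ → ℝ) : Measure ℝ :=
  unitMeasure.withDensity fun x => ENNReal.ofReal (1 / sigma a b x)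

/-- `L²_{1/σ}(0,1)`, with `‖u‖² = ∫₀¹ u² / σ`. (As `σ` is bounded on `(0,1)`, these functions are
automatically in `L²(0,1)`.) -/
abbrev L2w (a b : ℝ → ℝ) : Type := Lp ℝ 2 (weightMeasure a b)

/-- `L²(0,1)`. -/
abbrev L2unit : Type := Lp ℝ 2 unitMeasure

lemma intervalIntegrable_L2 (w : L2unit) {x : ℝ} (hx : x ∈ Ioo (0 : ℝ) 1) :
    IntervalIntegrable w volume 0 x := by
  have h : Integrable w unitMeasure := (Lp.memLp w).integrable (by norm_num)
  rw [intervalIntegrable_iff_integrableOn_Ioo_of_le hx.1.le]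
  exact IntegrableOn.mono_set h (Ioo_subset_Ioo_right hx.2.le)

lemma ae_weight_mem (a b : ℝ → ℝ) : ∀ᵐ x ∂(weightMeasure a b), x ∈ Ioo (0 : ℝ) 1 :=
  (withDensity_absolutelyContinuous _ _).ae_le (ae_restrict_mem measurableSet_Ioo)

lemma ae_eq_on {f g : ℝ → ℝ} (h : f =ᵐ[unitMeasure] g) {x : ℝ} (hx : x ∈ Ioo (0 : ℝ) 1) :
    ∫ s in (0 : ℝ)..x, f s = ∫ s in (0 : ℝ)..x, g s := by
  rw [intervalIntegral.integral_of_le hx.1.le, intervalIntegral.integral_of_le hx.1.le,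
    integral_Ioc_eq_integral_Ioo, integral_Ioc_eq_integral_Ioo]
  exact integral_congr_ae (ae_restrict_of_ae_restrict_of_subset (Ioo_subset_Ioo_right hx.2.le) h)

/-- `H¹_{1/σ,0}(0,1)`: the functions `u ∈ L²_{1/σ}(0,1)` that are (a.e. equal to) an absolutely
continuous function on `[0,1]` vanishing at `0` with derivative `u' ∈ L²(0,1)`. An element is the
pair `(u, u')`, in which `u'` is determined by `u`; the norm is `‖u‖² = ∫₀¹ u² / σ + ∫₀¹ (u')²`,
which is equivalent to the one with weight `η` in the second integral, as `η` is bounded above and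
below by positive constants. -/
def H1Zero (a b : ℝ → ℝ) : Submodule ℝ (WithLp 2 (L2w a b × L2unit)) where
  carrier := {p | ∀ᵐ x ∂(weightMeasure a b), p.fst x = ∫ s in (0 : ℝ)..x, p.snd s}
  zero_mem' := by
    filter_upwards [Lp.coeFn_zero ℝ 2 (weightMeasure a b), ae_weight_mem a b] with x h1 hx
    have h2 : ∫ s in (0 : ℝ)..x, (0 : L2unit) s = ∫ s in (0 : ℝ)..x, (0 : ℝ → ℝ) s :=
      ae_eq_on (Lp.coeFn_zero ℝ 2 unitMeasure) hx
    rw [WithLp.zero_fst, WithLp.zero_snd, h2, h1]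
    simp
  add_mem' := by
    intro p q hp hq
    filter_upwards [hp, hq, Lp.coeFn_add p.fst q.fst, ae_weight_mem a b] with x h1 h2 h3 hx
    have h4 := ae_eq_on (Lp.coeFn_add p.snd q.snd) hx
    have h5 := intervalIntegral.integral_add (intervalIntegrable_L2 p.snd hx)
      (intervalIntegrable_L2 q.snd hx)
    simp only [Pi.add_apply] at h3 h4
    rw [WithLp.add_fst, WithLp.add_snd, h3, h4, h5, h1, h2]
  smul_mem' := by
    intro c p hp
    filter_upwards [hp, Lp.coeFn_smul c p.fst, ae_weight_mem a b] with x h1 h3 hx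
    have h4 := ae_eq_on (Lp.coeFn_smul c p.snd) hx
    simp only [Pi.smul_apply, smul_eq_mul, intervalIntegral.integral_const_mul] at h3 h4
    rw [WithLp.smul_fst, WithLp.smul_snd, h3, h4, h1]

variable {a b : ℝ → ℝ}

/-- The inclusion `H¹_{1/σ,0}(0,1) ⊆ L²_{1/σ}(0,1)`. -/
def toL2w (u : H1Zero a b) : L2w a b := (u : WithLp 2 (L2w a b × L2unit)).fst

/-- The derivative `u'` of `u ∈ H¹_{1/σ,0}(0,1)`. -/
def dx (u : H1Zero a b) : L2unit := (u : WithLp 2 (L2w a b × L2unit)).snd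

/-- The value at `x ∈ [0,1]` of the continuous representative of `u ∈ H¹_{1/σ,0}(0,1)`. -/
def val (u : H1Zero a b) (x : ℝ) : ℝ := ∫ s in (0 : ℝ)..x, dx u s

/-- `H¹_{1/σ,0}(0,1)` is complete, so that Bochner integrals in it make sense. -/
instance : CompleteSpace (H1Zero a b) := by
  refine IsClosed.completeSpace_coe (hs := ?_)
  refine isClosed_of_closure_subset fun p hp => ?_
  obtain ⟨q, hq, hlim⟩ := mem_closure_iff_seq_limit.1 hp
  have h1 : Tendsto (fun n => (q n).fst) atTop (𝓝 p.fst) :=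
    ((WithLp.prod_continuous_ofLp 2 _ _).fst.tendsto p).comp hlim
  have h2 : Tendsto (fun n => (q n).snd) atTop (𝓝 p.snd) :=
    ((WithLp.prod_continuous_ofLp 2 _ _).snd.tendsto p).comp hlim
  obtain ⟨ns, hns, hae⟩ := (tendstoInMeasure_of_tendsto_Lp h1).exists_seq_tendsto_ae
  have hall : ∀ᵐ x ∂(weightMeasure a b), ∀ n, (q n).fst x = ∫ s in (0 : ℝ)..x, (q n).snd s :=
    ae_all_iff.2 hq
  change ∀ᵐ x ∂(weightMeasure a b), p.fst x = ∫ s in (0 : ℝ)..x, p.snd s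
  filter_upwards [hae, hall, ae_weight_mem a b] with x hx1 hx2 hx
  refine tendsto_nhds_unique hx1 ?_
  simp only [hx2]
  have h3 : Tendsto (fun n => ∫ s in Ioo 0 x, (q n).snd s ∂unitMeasure) atTop
      (𝓝 (∫ s in Ioo 0 x, p.snd s ∂unitMeasure)) := by
    have hc : Continuous fun w : L2unit => ∫ s in Ioo 0 x, w s ∂unitMeasure := by
      have hfin : unitMeasure (Ioo 0 x) ≠ ⊤ := measure_ne_top _ _
      have := (innerSL ℝ (indicatorConstLp 2 (measurableSet_Ioo (a := (0 : ℝ)) (b := x))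
        hfin (1 : ℝ))).continuous
      refine this.congr fun w => ?_
      rw [innerSL_apply_apply, L2.inner_indicatorConstLp_one]
    exact (hc.tendsto _).comp h2
  have h4 : ∀ w : L2unit, ∫ s in Ioo 0 x, w s ∂unitMeasure = ∫ s in (0 : ℝ)..x, w s := by
    intro w
    rw [intervalIntegral.integral_of_le hx.1.le, integral_Ioc_eq_integral_Ioo,
      Measure.restrict_restrict measurableSet_Ioo,
      inter_eq_left.2 (Ioo_subset_Ioo_right hx.2.le)]
  simp only [h4] at h3
  exact h3.comp hns.tendsto_atTop

/-- `u ∈ H²_{1/σ,0}(0,1)`, `A u = σ (η u')' = f` with `f ∈ L²_{1/σ}(0,1)`, and `(η u')(1) = c`: that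
is, `η u'` is locally absolutely continuous on `(0,1]`, with derivative `f / σ` and value `c`
at `1`. -/
def HasOp (u : H1Zero a b) (f : L2w a b) (c : ℝ) : Prop :=
  ∀ᵐ x ∂unitMeasure, eta a b x * dx u x = c - ∫ s in x..1, f s / sigma a b s

/-- The graph of the operator `𝒜 (u, v) = (v, A u)` with domain the `(u, v)` in
`H²_{1/σ,0} × H¹_{1/σ,0}` such that `(η u')(1) + v(1) + β u(1) = 0`: the proposition says that
`X` is in the domain and `𝒜 X = W`. -/
def IsWaveOp (β : ℝ) (X W : H1Zero a b × L2w a b) : Prop :=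
  toL2w W.1 = X.2 ∧ ∃ c : ℝ, HasOp X.1 W.2 c ∧ c + val W.1 1 + β * val X.1 1 = 0

/-- The domain of `𝒜`. -/
def waveDomain (a b : ℝ → ℝ) (β : ℝ) : Set (H1Zero a b × L2w a b) := {X | ∃ W, IsWaveOp β X W}

/-- The norm of `ℋ₀`: `‖(u, v)‖² = ∫₀¹ (u')² + ∫₀¹ v² / σ + β u(1)²`. -/
def energyNorm (β : ℝ) (X : H1Zero a b × L2w a b) : ℝ :=
  Real.sqrt (‖dx X.1‖ ^ 2 + ‖X.2‖ ^ 2 + β * val X.1 1 ^ 2)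

/-- The time derivative `y_t(t)`, `t ≥ 0`, taken in `L²_{1/σ}(0,1)` (one-sided at `t = 0`). -/
def velocity (y : ℝ → H1Zero a b) (t : ℝ) : L2w a b :=
  derivWithin (fun s => toL2w (y s)) (Ici 0) t

/-- `Y(t) = (y(t), y_t(t))`. -/
def state (y : ℝ → H1Zero a b) (t : ℝ) : H1Zero a b × L2w a b := (y t, velocity y t)

/-- `y` is a mild solution with initial data `Y₀ = (y₀, y₁)`: the function `Y = (y, y_t)` is
continuous on `[0,∞)` with values in `H¹_{1/σ,0} × L²_{1/σ}` and, for all `t ≥ 0`, `∫₀ᵗ Y` is in the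
domain of `𝒜` and `Y(t) = Y₀ + 𝒜 ∫₀ᵗ Y`. -/
structure IsMildSolution (β : ℝ) (Y₀ : H1Zero a b × L2w a b) (y : ℝ → H1Zero a b) : Prop where
  continuousOn_state : ContinuousOn (state y) (Ici 0)
  integrated : ∀ t, 0 ≤ t → IsWaveOp β (∫ s in (0 : ℝ)..t, state y s) (state y t - Y₀)

/-- `y` is a classical solution of `y_tt = a y_xx + b y_x`, `y_t(t,1) + η(1) y_x(t,1) + β y(t,1) = 0`
(and `y(t,0) = 0`, which holds in the space `H¹_{1/σ,0}`), for all `t ≥ 0`. -/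
structure IsClassicalSolution (β : ℝ) (y : ℝ → H1Zero a b) : Prop where
  /-- `y ∈ C²([0,∞); L²_{1/σ})` -/
  contDiffOn_two : ContDiffOn ℝ 2 (fun t => toL2w (y t)) (Ici 0)
  /-- `y ∈ C¹([0,∞); H¹_{1/σ,0})` -/
  contDiffOn_one : ContDiffOn ℝ 1 y (Ici 0)
  /-- the time derivatives in `L²_{1/σ}` and in `H¹_{1/σ,0}` agree -/
  velocity_eq : ∀ t, 0 ≤ t → velocity y t = toL2w (derivWithin y (Ici 0) t)
  /-- `y ∈ C([0,∞); H²_{1/σ,0})`: the `H²` norm is `‖u‖₂² = ‖u‖₁² + ‖A u‖²_{1/σ}`. -/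
  continuousOn_H2 : ContinuousOn y (Ici 0) ∧ ∃ F : ℝ → L2w a b, ContinuousOn F (Ici 0) ∧
    ∀ t, 0 ≤ t → ∃ c, HasOp (y t) (F t) c
  /-- The equation as the identity `y_tt = A y` in `L²_{1/σ}`, and the boundary condition. -/
  equation : ∀ t, 0 ≤ t → ∃ c, HasOp (y t) (derivWithin (velocity y) (Ici 0) t) c ∧
    val (derivWithin y (Ici 0) t) 1 + c + β * val (y t) 1 = 0
  /-- The same in terms of `p = y_x(t,·)`, locally absolutely continuous on `(0,1]`, and of
  `r = y_xx(t,·)`, its derivative. -/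
  equation_ae : ∀ t, 0 ≤ t → ∃ p r : ℝ → ℝ, (∀ᵐ x ∂unitMeasure, dx (y t) x = p x) ∧
    (∀ x ∈ Ioc (0 : ℝ) 1, IntervalIntegrable r volume x 1 ∧ p x = p 1 - ∫ s in x..1, r s) ∧
    (∀ᵐ x ∂unitMeasure, derivWithin (velocity y) (Ici 0) t x = a x * r x + b x * p x) ∧
    val (derivWithin y (Ici 0) t) 1 + eta a b 1 * p 1 + β * val (y t) 1 = 0

end

end DegenerateWave

open DegenerateWave

/-! In the variables `Y = (y, y_t)` the problem is a linear evolution equation `Y' = 𝒜 Y`, and the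
theorem is the Lumer–Phillips theorem for `𝒜`, supplemented by a Hardy inequality when `K ≤ 2`.

The abstract half works with the graph `G` of an operator and an inner product `B` equivalent to the
norm. Quasi-dissipativity gives an energy inequality for mild solutions (`IsMild.apply_self_le`),
hence uniqueness and continuous dependence. Existence (`IsGenerator.exists_isMild`) follows Yosida:
the bounded operators `μ (μ R - 1)`, with `R = (μ - 𝒜)⁻¹`, generate exponentials that are uniformly
Cauchy on bounded time intervals, and closedness of `G` passes the integrated equation to the limit.
If the data lie in the domain, the mild solution starting at `𝒜 x₀` is the time derivative of the
one starting at `x₀`, which gives strict solutions.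

The concrete half rests on the weak form of `HasOp` (`CoeffHyp.hasOp_iff`): `∫ η u' w' + ∫ f w / σ =
c w(1)` for all `w` in `H¹_{1/σ,0}`. The delicate point is that integration by parts leaves no
boundary term at the degenerate end. Since `w(x)² ≤ x ‖w'‖²`, a nonzero limit of `η u' w` would
force `(η u')²` to dominate a multiple of `1/x`, although `η u'` is square integrable. The weak form
makes the graph closed, gives the energy identity with dissipation `-v(1)²`
(`CoeffHyp.stateForm_waveOp`), and turns the resolvent equation into a Lax–Milgram problem.

Two forms are used. With the term `∫ u² / σ` included, the form is coercive on `H¹ × L²`, but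
dissipative only up to `ω = 1/2`, whence bounds that depend on the time interval. Without it, the
form is truly dissipative and gives bounds in the energy norm uniform in time. When `K ≤ 2`, `1/σ`
is at most a multiple of `1/x²`, so Hardy's inequality bounds the full norm by the energy norm. -/

namespace DissipativeEvolution

/-! ### Graphs of dissipative operators, the energy inequality and uniqueness. -/

section

variable {E : Type*} [NormedAddCommGroup E] [NormedSpace ℝ E]

/-- `X` is a mild solution of `X' = 𝒜 X`, `X(0) = x₀`, where `G` is the graph of `𝒜`. -/
structure IsMild (G : Submodule ℝ (E × E)) (x₀ : E) (X : ℝ → E) : Prop where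
  continuousOn : ContinuousOn X (Ici 0)
  mem : ∀ t, 0 ≤ t → (∫ s in (0 : ℝ)..t, X s, X t - x₀) ∈ G

/-- `G` is the graph of a closed, densely defined operator which is quasi-dissipative with respect
to the inner product `B`, and maximal with this property. -/
structure IsGenerator (G : Submodule ℝ (E × E)) (B : E →L[ℝ] E →L[ℝ] ℝ) (ω : ℝ) : Prop where
  isClosed : IsClosed (G : Set (E × E))
  symm : ∀ x y, B x y = B y x
  coercive : ∃ m : ℝ, 0 < m ∧ ∀ x, m * ‖x‖ ^ 2 ≤ B x x
  nonneg : 0 ≤ ω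
  dissipative : ∀ p ∈ G, B p.2 p.1 ≤ ω * B p.1 p.1
  range : ∀ μ, ω < μ → ∀ z, ∃ p ∈ G, μ • p.1 - p.2 = z
  dense : Dense (Prod.fst '' (G : Set (E × E)))

/-- By symmetry of `B` the derivative of `B(X, X)` is `2 B(X', X)`, so Gronwall's inequality
applies. `B` is not assumed positive: the lemma also has to serve forms that control only part of
the norm. -/
lemma apply_self_le_gronwallBound (B : E →L[ℝ] E →L[ℝ] ℝ) (hB : ∀ x y, B x y = B y x)
    {X X' : ℝ → E} {K ε T : ℝ} (hX : ∀ t ∈ Icc 0 T, HasDerivAt X (X' t) t)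
    (h : ∀ t ∈ Icc 0 T, 2 * B (X' t) (X t) ≤ K * B (X t) (X t) + ε) :
    ∀ t ∈ Icc 0 T, B (X t) (X t) ≤ gronwallBound (B (X 0) (X 0)) K ε t := by
  have hd : ∀ t ∈ Icc 0 T, HasDerivAt (fun s => B (X s) (X s)) (2 * B (X' t) (X t)) t := by
    intro t ht
    have h1 := B.hasFDerivAt (x := X t) |>.comp_hasDerivAt t (hX t ht)
    have h2 := h1.clm_apply (hX t ht)
    convert! h2 using 1
    simp only [Function.comp]
    rw [hB (X t) (X' t)]; ring
  intro t ht
  have := le_gronwallBound_of_liminf_deriv_right_le (f := fun s => B (X s) (X s))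
    (f' := fun t => 2 * B (X' t) (X t)) (δ := B (X 0) (X 0)) (K := K) (ε := ε) (a := 0) (b := T)
    (fun s hs => (hd s hs).continuousAt.continuousWithinAt)
    (fun s hs r hr => (hd s (Ico_subset_Icc_self hs)).hasDerivWithinAt.liminf_right_slope_le hr)
    le_rfl (fun s hs => h s (Ico_subset_Icc_self hs)) t ht
  simpa using this

variable {G : Submodule ℝ (E × E)} {B : E →L[ℝ] E →L[ℝ] ℝ} {ω : ℝ}

namespace IsGenerator

lemma apply_self_nonneg (h : IsGenerator G B ω) (x : E) : 0 ≤ B x x := by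
  obtain ⟨m, hm, hx⟩ := h.coercive
  exact (by positivity : (0 : ℝ) ≤ m * ‖x‖ ^ 2).trans (hx x)

lemma eq_zero_of_apply_self (h : IsGenerator G B ω) {x : E} (hx : B x x ≤ 0) : x = 0 := by
  obtain ⟨m, hm, h1⟩ := h.coercive
  have h2 : ‖x‖ ^ 2 ≤ 0 := by
    have := h1 x
    by_contra hc
    push Not at hc
    nlinarith [mul_pos hm hc]
  exact norm_eq_zero.1 (pow_eq_zero_iff (two_ne_zero)|>.1 (le_antisymm h2 (sq_nonneg _)))

lemma apply_sub_self (h : IsGenerator G B ω) (x y : E) :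
    B (x - y) (x - y) = B x x - 2 * B x y + B y y := by
  simp only [map_sub, sub_apply]
  rw [h.symm y x]; ring

lemma two_mul_apply_le (h : IsGenerator G B ω) (x y : E) :
    2 * B x y ≤ B x x + B y y := by
  have := h.apply_self_nonneg (x - y)
  rw [h.apply_sub_self] at this
  linarith

/-- The operator with graph `G` is single valued. -/
lemma eq_zero_of_mem (h : IsGenerator G B ω) {y : E} (hy : ((0 : E), y) ∈ G) : y = 0 := by
  have h1 : ∀ p ∈ G, B y p.1 ≤ 0 := by
    intro p hp
    by_contra hc
    push Not at hc
    -- Adding `s • (0, y)` to `p` leaves the first component unchanged, so dissipativity bounds a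
    -- linear function of `s` on the whole line from above; its slope cannot be positive.
    have h2 : ∀ s : ℝ, s * B y p.1 ≤ ω * B p.1 p.1 - B p.2 p.1 := by
      intro s
      have := h.dissipative _ (G.add_mem hp (G.smul_mem s hy))
      simp only [Prod.fst_add, Prod.snd_add, Prod.smul_fst, Prod.smul_snd, smul_zero, add_zero,
        map_add, map_smul, add_apply, smul_apply,
        smul_eq_mul] at this
      linarith
    have := h2 ((ω * B p.1 p.1 - B p.2 p.1 + 1) / B y p.1)
    rw [div_mul_cancel₀ _ hc.ne'] at this
    linarith
  have h3 : ∀ x, B y x ≤ 0 := by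
    have hcl : IsClosed {x | B y x ≤ 0} := isClosed_le (B y).continuous continuous_const
    have : closure (Prod.fst '' (G : Set (E × E))) ⊆ {x | B y x ≤ 0} :=
      closure_minimal (by rintro _ ⟨p, hp, rfl⟩; exact h1 p hp) hcl
    rw [h.dense.closure_eq] at this
    exact fun x => this (mem_univ x)
  exact h.eq_zero_of_apply_self (h3 y)

lemma fst_eq_zero (h : IsGenerator G B ω) {μ : ℝ} (hμ : ω < μ) {p : E × E} (hp : p ∈ G)
    (h0 : μ • p.1 - p.2 = 0) : p.1 = 0 := by
  apply h.eq_zero_of_apply_self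
  have h1 := h.dissipative p hp
  rw [← sub_eq_zero.1 h0, map_smul, smul_apply, smul_eq_mul] at h1
  by_contra hc
  push Not at hc
  nlinarith

end IsGenerator

/-- A closed subspace is complete, so the path can be integrated inside `G` itself. Composition with
`projIcc` makes the path continuous on all of `ℝ` without changing it on the interval of
integration. -/
lemma integral_mem [CompleteSpace E] (hG : IsClosed (G : Set (E × E))) {X Y : ℝ → E}
    {t : ℝ} (ht : 0 ≤ t) (hX : ContinuousOn X (Icc 0 t)) (hY : ContinuousOn Y (Icc 0 t))
    (hm : ∀ s ∈ Icc 0 t, (X s, Y s) ∈ G) :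
    (∫ s in (0 : ℝ)..t, X s, ∫ s in (0 : ℝ)..t, Y s) ∈ G := by
  have hcpl : CompleteSpace G := hG.completeSpace_coe
  let F : ℝ → G := fun s =>
    ⟨(X (projIcc 0 t ht s), Y (projIcc 0 t ht s)), hm _ (projIcc 0 t ht s).2⟩
  have hF : Continuous F := by
    apply Continuous.subtype_mk
    exact ((continuousOn_iff_continuous_domRestrict.1 hX).comp continuous_projIcc).prodMk
      ((continuousOn_iff_continuous_domRestrict.1 hY).comp continuous_projIcc)
  have hint := hF.intervalIntegrable (μ := volume) 0 t
  have h1 := ((ContinuousLinearMap.fst ℝ E E).comp G.subtypeL).intervalIntegral_comp_comm hint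
  have h2 := ((ContinuousLinearMap.snd ℝ E E).comp G.subtypeL).intervalIntegral_comp_comm hint
  have h3 : ∀ s ∈ uIcc 0 t, (projIcc 0 t ht s : ℝ) = s := by
    intro s hs
    rw [uIcc_of_le ht] at hs
    rw [projIcc_of_mem ht hs]
  have e1 : ∫ s in (0 : ℝ)..t, X s = (∫ s in (0 : ℝ)..t, F s : G).1.1 := by
    refine Eq.trans (intervalIntegral.integral_congr fun s hs => ?_) h1
    simp [F, h3 s hs]
  have e2 : ∫ s in (0 : ℝ)..t, Y s = (∫ s in (0 : ℝ)..t, F s : G).1.2 := by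
    refine Eq.trans (intervalIntegral.integral_congr fun s hs => ?_) h2
    simp [F, h3 s hs]
  rw [e1, e2]
  exact (∫ s in (0 : ℝ)..t, F s : G).2

lemma IsMild.congr {x₀ : E} {X Y : ℝ → E} (hX : IsMild G x₀ X) (h : EqOn Y X (Ici 0)) :
    IsMild G x₀ Y where
  continuousOn := hX.continuousOn.congr h
  mem t ht := by
    have : ∫ s in (0 : ℝ)..t, Y s = ∫ s in (0 : ℝ)..t, X s := by
      refine intervalIntegral.integral_congr fun s hs => h ?_
      rw [uIcc_of_le ht] at hs
      exact hs.1
    rw [this, h ht]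
    exact hX.mem t ht

lemma IsMild.intervalIntegrable {x₀ : E} {X : ℝ → E} (hX : IsMild G x₀ X) {t : ℝ} (ht : 0 ≤ t) :
    IntervalIntegrable X volume 0 t := by
  apply ContinuousOn.intervalIntegrable
  rw [uIcc_of_le ht]
  exact hX.continuousOn.mono fun s hs => hs.1

lemma IsMild.sub {x₀ y₀ : E} {X Y : ℝ → E} (hX : IsMild G x₀ X) (hY : IsMild G y₀ Y) :
    IsMild G (x₀ - y₀) (fun t => X t - Y t) where
  continuousOn := hX.continuousOn.sub hY.continuousOn
  mem t ht := by
    rw [intervalIntegral.integral_sub (hX.intervalIntegrable ht) (hY.intervalIntegrable ht)]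
    convert G.sub_mem (hX.mem t ht) (hY.mem t ht) using 1
    ext <;> simp
    abel

lemma IsGenerator.mild_zero (h : IsGenerator G B ω) {x₀ : E} {X : ℝ → E} (hX : IsMild G x₀ X) : X 0 = x₀ := by
  have := hX.mem 0 le_rfl
  rw [intervalIntegral.integral_same] at this
  exact sub_eq_zero.1 (h.eq_zero_of_mem this)

variable [CompleteSpace E]

/-- A mild solution need not be differentiable, but its primitive `J` is. The increment `J (s + δ) -
J s` solves the equation strictly, since the initial value cancels in the difference. Gronwall's
inequality applies to it, and division by `δ` and `δ → 0` recover `X`. The form `B'` is independent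
of the one in `IsGenerator` and need not be coercive. -/
lemma IsMild.apply_self_le {x₀ : E} {X : ℝ → E} (hX : IsMild G x₀ X) {B' : E →L[ℝ] E →L[ℝ] ℝ}
    {ω' : ℝ} (hsymm : ∀ x y, B' x y = B' y x)
    (hdiss : ∀ p ∈ G, B' p.2 p.1 ≤ ω' * B' p.1 p.1) {t : ℝ} (ht : 0 ≤ t) :
    B' (X t) (X t) ≤ Real.exp (2 * ω' * t) * B' (X 0) (X 0) := by
  -- Extending `X` by the constant `X 0` to negative times makes `J` differentiable everywhere, in
  -- particular two-sidedly at `0`.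
  wlog hc : Continuous X generalizing X
  · have hcont : Continuous fun s => X (max 0 s) :=
      hX.continuousOn.comp_continuous (by fun_prop) fun s => mem_Ici.2 (le_max_left _ _)
    have := this (hX.congr fun s (hs : 0 ≤ s) => by simp only [max_eq_right hs]) hcont
    simpa [max_eq_right ht] using this
  have hder : ∀ s, HasDerivAt (fun r => ∫ u in (0 : ℝ)..r, X u) (X s) s := fun s =>
    intervalIntegral.integral_hasDerivAt_right (hc.intervalIntegrable _ _)
      (hc.stronglyMeasurableAtFilter _ _) hc.continuousAt
  set J : ℝ → E := fun r => ∫ u in (0 : ℝ)..r, X u with hJ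
  have key : ∀ δ : ℝ, 0 < δ → B' (δ⁻¹ • (J (t + δ) - J t)) (δ⁻¹ • (J (t + δ) - J t)) ≤
      Real.exp (2 * ω' * t) * B' (δ⁻¹ • (J (0 + δ) - J 0)) (δ⁻¹ • (J (0 + δ) - J 0)) := by
    intro δ hδ
    have h1 := apply_self_le_gronwallBound B' hsymm (X := fun s => J (s + δ) - J s)
      (X' := fun s => X (s + δ) - X s) (K := 2 * ω') (ε := 0) (T := t)
      (fun s _ => ((hder (s + δ)).comp_add_const s δ).sub (hder s))
      (fun s hs => by
        have hm : (J (s + δ) - J s, X (s + δ) - X s) ∈ G := by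
          convert G.sub_mem (hX.mem (s + δ) (by linarith [hs.1])) (hX.mem s hs.1) using 1
          ext <;> simp [J]
        have := hdiss _ hm
        dsimp only at this
        linarith) t ⟨ht, le_rfl⟩
    rw [gronwallBound_ε0] at h1
    simp only [map_smul, smul_apply, smul_eq_mul]
    have h2 : 0 ≤ δ⁻¹ * δ⁻¹ := by positivity
    nlinarith [mul_le_mul_of_nonneg_left h1 h2]
  have hlim : ∀ s, Tendsto (fun δ : ℝ => δ⁻¹ • (J (s + δ) - J s)) (𝓝[>] 0) (𝓝 (X s)) := fun s =>
    (hder s).tendsto_slope_zero_right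
  have hquad : Continuous fun x : E => B' x x := by fun_prop
  exact le_of_tendsto_of_tendsto ((hquad.tendsto _).comp (hlim t))
    (((hquad.tendsto _).comp (hlim 0)).const_mul _)
    (eventually_nhdsWithin_of_forall fun δ hδ => key δ hδ)

namespace IsGenerator

lemma mild_unique (h : IsGenerator G B ω) {x₀ : E} {X Y : ℝ → E} (hX : IsMild G x₀ X)
    (hY : IsMild G x₀ Y) : EqOn X Y (Ici 0) := by
  intro t ht
  have h1 := (hX.sub hY).apply_self_le h.symm h.dissipative ht
  rw [h.mild_zero hX, h.mild_zero hY, sub_self, map_zero, mul_zero] at h1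
  exact sub_eq_zero.1 (h.eq_zero_of_apply_self h1)

end IsGenerator

end

/-! ### Resolvents and their bounds in the form `B`. -/

section

variable {E : Type*} [NormedAddCommGroup E] [NormedSpace ℝ E]
variable {G : Submodule ℝ (E × E)} {B : E →L[ℝ] E →L[ℝ] ℝ} {ω : ℝ}

/-- `R` is the resolvent `(μ - 𝒜)⁻¹`, where `G` is the graph of `𝒜`. -/
structure IsResolvent (G : Submodule ℝ (E × E)) (μ : ℝ) (R : E →L[ℝ] E) : Prop where
  mem : ∀ z, (R z, μ • R z - z) ∈ G
  apply_sub : ∀ p ∈ G, R (μ • p.1 - p.2) = p.1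

lemma IsResolvent.sub_apply {μ ν : ℝ} {R S : E →L[ℝ] E} (hR : IsResolvent G μ R)
    (hS : IsResolvent G ν S) (z : E) : R z = S z + (ν - μ) • R (S z) := by
  have h1 := hR.apply_sub _ (hS.mem z)
  have h2 : μ • S z - (ν • S z - z) = z - (ν - μ) • S z := by module
  dsimp only at h1
  rw [h2, map_sub, map_smul] at h1
  rw [sub_eq_iff_eq_add] at h1
  exact h1

/-- The resolvent identity, written with the roles of `R` and `S` exchanged, gives `(ν - μ)(R S - S
R) = 0`. -/
lemma IsResolvent.commute {μ ν : ℝ} {R S : E →L[ℝ] E} (hR : IsResolvent G μ R)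
    (hS : IsResolvent G ν S) (hne : μ ≠ ν) : Commute R S := by
  ext z
  have h1 := hR.sub_apply hS z
  have h2 := hS.sub_apply hR z
  have h3 : (ν - μ) • (R (S z) - S (R z)) = 0 := by
    have h4 : (ν - μ) • (R (S z) - S (R z)) =
        (S z + (ν - μ) • R (S z)) - S z + ((R z + (μ - ν) • S (R z)) - R z) := by module
    rw [h4, ← h1, ← h2]; abel
  exact sub_eq_zero.1 ((smul_eq_zero.1 h3).resolve_left (sub_ne_zero.2 hne.symm))

namespace IsGenerator

lemma exists_isResolvent (h : IsGenerator G B ω) {μ : ℝ} (hμ : ω < μ) :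
    ∃ R : E →L[ℝ] E, IsResolvent G μ R := by
  obtain ⟨m, hm, hcoer⟩ := h.coercive
  choose P hP hPz using h.range μ hμ
  have hPsnd : ∀ z, (P z).2 = μ • (P z).1 - z := fun z => by
    rw [eq_sub_iff_add_eq, add_comm, ← eq_sub_iff_add_eq, hPz z]
  have huniq : ∀ p ∈ G, ∀ z, μ • p.1 - p.2 = z → p.1 = (P z).1 := by
    intro p hp z hz
    refine sub_eq_zero.1 (h.fst_eq_zero hμ (G.sub_mem hp (hP z)) ?_)
    rw [Prod.fst_sub, Prod.snd_sub, smul_sub, sub_sub_sub_comm, hz, hPz, sub_self]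
  let L : E →ₗ[ℝ] E :=
    { toFun := fun z => (P z).1
      map_add' := fun z w => by
        refine (huniq _ (G.add_mem (hP z) (hP w)) _ ?_).symm
        rw [Prod.fst_add, Prod.snd_add, smul_add, add_sub_add_comm, hPz, hPz]
      map_smul' := fun c z => by
        refine (huniq _ (G.smul_mem c (hP z)) _ ?_).symm
        rw [Prod.smul_fst, Prod.smul_snd, smul_comm, ← smul_sub, hPz] }
  have hbound : ∀ z, ‖L z‖ ≤ ‖B‖ / (m * (μ - ω)) * ‖z‖ := by
    intro z
    have h1 := h.dissipative _ (hP z)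
    have h2 := hPsnd z
    rw [h2, map_sub, map_smul, sub_apply, smul_apply, smul_eq_mul] at h1
    have h3 : B z (P z).1 ≤ ‖B‖ * ‖z‖ * ‖(P z).1‖ :=
      (le_abs_self _).trans (B.le_opNorm₂ _ _)
    have h4 := hcoer (P z).1
    change ‖(P z).1‖ ≤ _
    rcases (norm_nonneg (P z).1).eq_or_lt with h0 | h0
    · rw [← h0]
      have : 0 < μ - ω := sub_pos.2 hμ
      positivity
    · have h5 : m * (μ - ω) * ‖(P z).1‖ * ‖(P z).1‖ ≤ ‖B‖ * ‖z‖ * ‖(P z).1‖ := by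
        nlinarith [mul_le_mul_of_nonneg_left h4 (sub_pos.2 hμ).le]
      have h6 := le_of_mul_le_mul_right h5 h0
      rw [div_mul_eq_mul_div, le_div_iff₀ (mul_pos hm (sub_pos.2 hμ))]
      linarith
  refine ⟨L.mkContinuous _ hbound, fun z => ?_, fun p hp => ?_⟩
  · change ((P z).1, μ • (P z).1 - z) ∈ G
    convert hP z using 1
    ext
    · rfl
    · exact (hPsnd z).symm
  · exact (huniq p hp _ rfl).symm

/-- Dissipativity at `(R z, μ R z - z)` reads `(μ - ω) B(R z, R z) ≤ B(z, R z)`; Young's inequality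
for `z` and `(μ - ω) R z` absorbs the right-hand side. -/
lemma resolvent_apply_self_le (h : IsGenerator G B ω) {μ : ℝ} (hμ : ω < μ) {R : E →L[ℝ] E}
    (hR : IsResolvent G μ R) (z : E) : (μ - ω) ^ 2 * B (R z) (R z) ≤ B z z := by
  have h1 := h.dissipative _ (hR.mem z)
  dsimp only at h1
  rw [map_sub, map_smul, sub_apply, smul_apply, smul_eq_mul] at h1
  have h2 := h.two_mul_apply_le z ((μ - ω) • R z)
  simp only [map_smul, smul_apply, smul_eq_mul] at h2
  nlinarith [mul_le_mul_of_nonneg_left h1 (sub_pos.2 hμ).le]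

/-- The resolvent `R` at `μ ≥ 2 ω + 1` satisfies `B(μ R z, μ R z) ≤ 4 B(z, z)`. -/
lemma smul_resolvent_apply_self_le (h : IsGenerator G B ω) {μ : ℝ} (hμ : 2 * ω + 1 ≤ μ)
    {R : E →L[ℝ] E} (hR : IsResolvent G μ R) (z : E) :
    B (μ • R z) (μ • R z) ≤ 4 * B z z := by
  have hω := h.nonneg
  have h1 := h.resolvent_apply_self_le (by linarith) hR z
  have h2 := h.apply_self_nonneg (R z)
  simp only [map_smul, smul_apply, smul_eq_mul]
  have h3 : μ * μ ≤ 4 * (μ - ω) ^ 2 := by nlinarith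
  nlinarith [mul_le_mul_of_nonneg_right h3 h2]

/-- The Yosida approximation is quasi-dissipative. -/
lemma yosida_dissipative (h : IsGenerator G B ω) {μ : ℝ} (hμ : 2 * ω + 1 ≤ μ)
    {R : E →L[ℝ] E} (hR : IsResolvent G μ R) (z : E) :
    B (μ • (μ • R z - z)) z ≤ 2 * ω * B z z := by
  have hω := h.nonneg
  have hμω : 0 < μ - ω := by linarith
  have h1 := h.resolvent_apply_self_le (by linarith) hR z
  have h2 := h.two_mul_apply_le ((μ - ω) • R z) z
  simp only [map_smul, smul_apply, smul_eq_mul] at h2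
  simp only [map_smul, map_sub, smul_apply, sub_apply, smul_eq_mul]
  have h3 : (μ - ω) * B (R z) z ≤ B z z := by nlinarith
  have h4 := h.apply_self_nonneg z
  -- The sharp constant is `μ ω / (μ - ω)`; it is at most `2 ω` because `μ ≥ 2 ω`.
  have h5 : (μ - ω) * (μ * (μ * B (R z) z - B z z)) ≤ (μ - ω) * (2 * ω * B z z) := by
    have : μ ^ 2 * ((μ - ω) * B (R z) z) ≤ μ ^ 2 * B z z :=
      mul_le_mul_of_nonneg_left h3 (sq_nonneg _)
    have h6 : 0 ≤ ω * (μ - 2 * ω) * B z z :=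
      mul_nonneg (mul_nonneg hω (by linarith)) h4
    nlinarith
  exact le_of_mul_le_mul_left h5 hμω

end IsGenerator

end

/-! ### Yosida approximation and convergence of the exponentials. -/

section

variable {E : Type*} [NormedAddCommGroup E] [NormedSpace ℝ E]
variable {G : Submodule ℝ (E × E)} {B : E →L[ℝ] E →L[ℝ] ℝ} {ω : ℝ}

/-- The Yosida approximation `μ (μ R - 1)` of `𝒜`, where `R = (μ - 𝒜)⁻¹`. -/
noncomputable def yosida (μ : ℝ) (R : E →L[ℝ] E) : E →L[ℝ] E := μ • (μ • R - 1)

lemma yosida_apply (μ : ℝ) (R : E →L[ℝ] E) (z : E) : yosida μ R z = μ • (μ • R z - z) := rfl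

lemma IsResolvent.yosida_mem {μ : ℝ} {R : E →L[ℝ] E} (hR : IsResolvent G μ R) (z : E) :
    (μ • R z, yosida μ R z) ∈ G :=
  G.smul_mem μ (hR.mem z)

lemma IsResolvent.yosida_fst {μ : ℝ} {R : E →L[ℝ] E} (hR : IsResolvent G μ R) {p : E × E}
    (hp : p ∈ G) : yosida μ R p.1 = μ • R p.2 := by
  have h1 := hR.apply_sub p hp
  rw [map_sub, map_smul, sub_eq_iff_eq_add] at h1
  rw [yosida_apply, h1]
  module

lemma IsResolvent.yosida_commute {μ ν : ℝ} {R S : E →L[ℝ] E} (hR : IsResolvent G μ R)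
    (hS : IsResolvent G ν S) (hne : μ ≠ ν) : Commute (yosida μ R) (yosida ν S) :=
  ((((hR.commute hS hne).smul_right ν).smul_left μ |>.sub_right (Commute.one_right _)).sub_left
    (Commute.one_left _)).smul_right ν |>.smul_left μ

/-- The semigroup generated by a bounded operator. -/
noncomputable def expFlow (A : E →L[ℝ] E) (t : ℝ) : E →L[ℝ] E := NormedSpace.exp (t • A)

namespace IsGenerator

lemma apply_add_self_le (h : IsGenerator G B ω) (x y : E) :
    B (x + y) (x + y) ≤ 2 * B x x + 2 * B y y := by
  have := h.apply_self_nonneg (x - y)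
  simp only [map_sub, sub_apply, map_add, add_apply] at this ⊢
  linarith

lemma tendsto_zero (h : IsGenerator G B ω) {ι : Type*} {l : Filter ι} {f : ι → E}
    (hf : Tendsto (fun i => B (f i) (f i)) l (𝓝 0)) : Tendsto f l (𝓝 0) := by
  obtain ⟨m, hm, hc⟩ := h.coercive
  rw [tendsto_zero_iff_norm_tendsto_zero]
  have h1 : Tendsto (fun i => Real.sqrt (m⁻¹ * B (f i) (f i))) l (𝓝 0) := by
    have := (Real.continuous_sqrt.tendsto _).comp (hf.const_mul m⁻¹)
    rwa [mul_zero, Real.sqrt_zero] at this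
  refine squeeze_zero (fun i => norm_nonneg _) (fun i => Real.le_sqrt_of_sq_le ?_) h1
  rw [inv_mul_eq_div, le_div_iff₀ hm]
  linarith [hc (f i)]

variable {R : ℕ → E →L[ℝ] E}

lemma exists_mem_apply_self_lt (h : IsGenerator G B ω) (x : E) {ε : ℝ} (hε : 0 < ε) :
    ∃ p ∈ G, B (x - p.1) (x - p.1) < ε := by
  have hopen : IsOpen {z : E | B (x - z) (x - z) < ε} :=
    isOpen_lt (by fun_prop) continuous_const
  obtain ⟨_, ⟨p, hp, rfl⟩, hz⟩ := h.dense.exists_mem_open hopen ⟨x, by simpa using hε⟩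
  exact ⟨p, hp, hz⟩

/-- On the domain `μ R x - x = R 𝒜 x`, which tends to zero like `1 / (n + 1)`. Density of the domain
and the uniform bound of `smul_resolvent_apply_self_le` extend the convergence to every `y`. -/
lemma tendsto_smul_resolvent (h : IsGenerator G B ω)
    (hR : ∀ n : ℕ, IsResolvent G (2 * ω + 1 + n) (R n)) (y : E) :
    Tendsto (fun n : ℕ => (2 * ω + 1 + n) • R n y) atTop (𝓝 y) := by
  have hω := h.nonneg
  rw [← tendsto_sub_nhds_zero_iff]
  apply h.tendsto_zero
  have key : ∀ p ∈ G, Tendsto (fun n => B (R n p.2) (R n p.2)) atTop (𝓝 0) := by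
    intro p _
    have h1 : Tendsto (fun n : ℕ => B p.2 p.2 / ((n : ℝ) + 1) ^ 2) atTop (𝓝 0) := by
      refine Tendsto.const_div_atTop (Tendsto.comp (tendsto_pow_atTop two_ne_zero)
        (tendsto_atTop_add_const_right _ _ tendsto_natCast_atTop_atTop)) _
    refine squeeze_zero (fun n => h.apply_self_nonneg _) (fun n => ?_) h1
    rw [le_div_iff₀ (by positivity), mul_comm]
    refine le_trans (mul_le_mul_of_nonneg_right ?_ (h.apply_self_nonneg _))
      (h.resolvent_apply_self_le (by linarith [(n.cast_nonneg : (0 : ℝ) ≤ n)]) (hR n) p.2)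
    gcongr
    linarith
  rw [tendsto_order]
  refine ⟨fun a ha => Eventually.of_forall fun n => ha.trans_le (h.apply_self_nonneg _),
    fun ε hε => ?_⟩
  -- The splitting below costs `2 · 4 + 4 = 12` times the distance term and `4` times the resolvent
  -- term, hence at most `16 ε / 24`.
  obtain ⟨p, hp, hyp⟩ := h.exists_mem_apply_self_lt y (ε := ε / 24) (by positivity)
  filter_upwards [(key p hp).eventually_lt_const (show (0 : ℝ) < ε / 24 by positivity)] with n hn
  have hμ : 2 * ω + 1 ≤ 2 * ω + 1 + (n : ℝ) := by linarith [(n.cast_nonneg : (0 : ℝ) ≤ n)]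
  set μ : ℝ := 2 * ω + 1 + n
  have e1 : μ • R n y - y = μ • R n (y - p.1) + (R n p.2 + -(y - p.1)) := by
    have h1 := (hR n).apply_sub p hp
    rw [map_sub, map_smul, sub_eq_iff_eq_add] at h1
    change μ • R n p.1 = _ at h1
    rw [map_sub, smul_sub, h1]; abel
  rw [e1]
  have h2 := h.apply_add_self_le (μ • R n (y - p.1)) (R n p.2 + -(y - p.1))
  have h3 := h.apply_add_self_le (R n p.2) (-(y - p.1))
  have h4 := h.smul_resolvent_apply_self_le hμ (hR n) (y - p.1)
  have h5 : B (-(y - p.1)) (-(y - p.1)) = B (y - p.1) (y - p.1) := by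
    rw [map_neg, map_neg, neg_apply, neg_neg]
  linarith

variable [CompleteSpace E]

lemma _root_.DissipativeEvolution.hasDerivAt_expFlow (A : E →L[ℝ] E) (x : E) (t : ℝ) :
    HasDerivAt (fun s => expFlow A s x) (A (expFlow A t x)) t := by
  have h1 := hasDerivAt_exp_smul_const' (𝕂 := ℝ) A t
  exact h1.clm_apply (hasDerivAt_const t x) |>.congr_deriv (by simp [expFlow])

lemma expFlow_apply_self_le (h : IsGenerator G B ω) {μ : ℝ} (hμ : 2 * ω + 1 ≤ μ)
    {S : E →L[ℝ] E} (hS : IsResolvent G μ S) (z : E) {t : ℝ} (ht : 0 ≤ t) :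
    B (expFlow (yosida μ S) t z) (expFlow (yosida μ S) t z) ≤ Real.exp (4 * ω * t) * B z z := by
  have := apply_self_le_gronwallBound B h.symm (X := fun s => expFlow (yosida μ S) s z)
    (K := 4 * ω) (ε := 0) (T := t) (fun s _ => hasDerivAt_expFlow _ z s)
    (fun s _ => by
      have := h.yosida_dissipative hμ hS (expFlow (yosida μ S) s z)
      rw [yosida_apply]
      linarith) t ⟨ht, le_rfl⟩
  rw [gronwallBound_ε0] at this
  simpa [expFlow, mul_comm] using this

/-- As the two Yosida approximations `A` and `A'` commute, the difference `D` of the flows satisfies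
`D' = A D + exp(s A') (A z - A' z)`, whose forcing term is controlled by `expFlow_apply_self_le`.
Young's inequality for the forcing adds `1` to the Gronwall rate `4 ω`; the rate is then nonzero
even if `ω = 0`. -/
lemma expFlow_sub_apply_self_le (h : IsGenerator G B ω) {μ ν : ℝ} (hμ : 2 * ω + 1 ≤ μ)
    (hν : 2 * ω + 1 ≤ ν) {S S' : E →L[ℝ] E} (hS : IsResolvent G μ S) (hS' : IsResolvent G ν S')
    (hne : μ ≠ ν) (z : E) {t T : ℝ} (ht : t ∈ Icc 0 T) :
    B (expFlow (yosida μ S) t z - expFlow (yosida ν S') t z)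
      (expFlow (yosida μ S) t z - expFlow (yosida ν S') t z) ≤
      Real.exp (4 * ω * T) * Real.exp ((4 * ω + 1) * T) *
        B (yosida μ S z - yosida ν S' z) (yosida μ S z - yosida ν S' z) := by
  have hω := h.nonneg
  set A := yosida μ S
  set A' := yosida ν S'
  set d := A z - A' z
  have hcomm : ∀ s, A (expFlow A' s z) - A' (expFlow A' s z) = expFlow A' s d := by
    intro s
    have h1 : Commute A (expFlow A' s) :=
      ((hS.yosida_commute hS' hne).smul_right s).exp_right
    have h2 : Commute A' (expFlow A' s) := ((Commute.refl A').smul_right s).exp_right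
    have h3 := DFunLike.congr_fun h1.eq z
    have h4 := DFunLike.congr_fun h2.eq z
    simp only [mul_apply_eq_comp] at h3 h4
    rw [h3, h4, map_sub]
  set ε := Real.exp (4 * ω * T) * B d d
  have hε : 0 ≤ ε := mul_nonneg (Real.exp_nonneg _) (h.apply_self_nonneg _)
  have hg := apply_self_le_gronwallBound B h.symm
    (X := fun s => expFlow A s z - expFlow A' s z)
    (K := 4 * ω + 1) (ε := ε) (T := T)
    (fun s _ => (hasDerivAt_expFlow A z s).sub (hasDerivAt_expFlow A' z s))
    (fun s hs => by
      have e1 : A (expFlow A s z) - A' (expFlow A' s z) =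
          A (expFlow A s z - expFlow A' s z) + expFlow A' s d := by
        rw [← hcomm, map_sub]; abel
      rw [e1, map_add, add_apply]
      have h1 := h.yosida_dissipative hμ hS (expFlow A s z - expFlow A' s z)
      rw [← yosida_apply] at h1
      have h2 := h.two_mul_apply_le (expFlow A' s d) (expFlow A s z - expFlow A' s z)
      have h3 := h.expFlow_apply_self_le hν hS' d hs.1
      have h4 : Real.exp (4 * ω * s) * B d d ≤ ε :=
        mul_le_mul_of_nonneg_right (Real.exp_le_exp.2 (by nlinarith [hs.2]))
          (h.apply_self_nonneg _)
      change B (A _) _ ≤ _ at h1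
      linarith) t ht
  refine hg.trans ?_
  have h0 : B (expFlow A 0 z - expFlow A' 0 z) (expFlow A 0 z - expFlow A' 0 z) = 0 := by
    simp [expFlow]
  rw [h0, gronwallBound_of_K_ne_0 (by linarith)]
  have h5 : Real.exp ((4 * ω + 1) * t) ≤ Real.exp ((4 * ω + 1) * T) :=
    Real.exp_le_exp.2 (by nlinarith [ht.2])
  have h6 : ε / (4 * ω + 1) ≤ ε := div_le_self hε (by linarith)
  have h7 : 0 ≤ ε / (4 * ω + 1) := by positivity
  have h8 := Real.exp_pos ((4 * ω + 1) * T)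
  calc 0 * Real.exp ((4 * ω + 1) * t) + ε / (4 * ω + 1) * (Real.exp ((4 * ω + 1) * t) - 1)
      ≤ ε / (4 * ω + 1) * Real.exp ((4 * ω + 1) * T) := by nlinarith
    _ ≤ ε * Real.exp ((4 * ω + 1) * T) := by gcongr
    _ = _ := by simp only [ε]; ring

lemma yosida_uniformCauchySeqOn (h : IsGenerator G B ω)
    (hR : ∀ n : ℕ, IsResolvent G (2 * ω + 1 + n) (R n)) (x₀ : E) (T : ℝ) :
    UniformCauchySeqOn (fun (n : ℕ) t => expFlow (yosida (2 * ω + 1 + n) (R n)) t x₀) atTop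
      (Icc 0 T) := by
  have hω := h.nonneg
  have hle : ∀ n : ℕ, 2 * ω + 1 ≤ 2 * ω + 1 + (n : ℝ) := fun n => by
    linarith [(n.cast_nonneg : (0 : ℝ) ≤ n)]
  obtain ⟨m, hm, hcoer⟩ := h.coercive
  rw [Metric.uniformCauchySeqOn_iff]
  intro ε hε
  set a := Real.exp (4 * ω * T)
  set b := Real.exp ((4 * ω + 1) * T)
  have ha : 0 < a := Real.exp_pos _
  have hb : 0 < b := Real.exp_pos _
  set δ := m * ε ^ 2 with hδ
  have hδ0 : 0 < δ := by positivity
  -- Only on the domain do the approximations converge to `𝒜`, so `x₀` is replaced by a nearby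
  -- `p.1`. The two error flows contribute at most `δ / 2` and the difference of flows at `p.1` at
  -- most `δ / 4`.
  obtain ⟨p, hp, hxp⟩ := h.exists_mem_apply_self_lt x₀ (ε := δ / (16 * a)) (by positivity)
  have hlim : Tendsto (fun n : ℕ => yosida (2 * ω + 1 + n) (R n) p.1) atTop (𝓝 p.2) := by
    simp only [fun n => (hR n).yosida_fst hp]
    exact h.tendsto_smul_resolvent hR p.2
  have hlim2 : Tendsto (fun k : ℕ × ℕ =>
      B (yosida (2 * ω + 1 + k.1) (R k.1) p.1 - yosida (2 * ω + 1 + k.2) (R k.2) p.1)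
        (yosida (2 * ω + 1 + k.1) (R k.1) p.1 - yosida (2 * ω + 1 + k.2) (R k.2) p.1))
      atTop (𝓝 0) := by
    have h1 : Tendsto (fun k : ℕ × ℕ => yosida (2 * ω + 1 + k.1) (R k.1) p.1 -
        yosida (2 * ω + 1 + k.2) (R k.2) p.1) atTop (𝓝 (p.2 - p.2)) := by
      rw [← prod_atTop_atTop_eq]
      exact (hlim.comp tendsto_fst).sub (hlim.comp tendsto_snd)
    have hq : Continuous fun x : E => B x x := by fun_prop
    have h2 := (hq.tendsto _).comp h1
    rwa [sub_self, map_zero] at h2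
  obtain ⟨⟨N₁, N₂⟩, hN⟩ := eventually_atTop.1
    (hlim2.eventually_lt_const (show (0 : ℝ) < δ / (8 * (a * b)) by positivity))
  refine ⟨max N₁ N₂, fun n hn k hk t ht => ?_⟩
  rcases eq_or_ne n k with rfl | hne
  · simpa using hε
  set x := expFlow (yosida (2 * ω + 1 + n) (R n)) t
  set y := expFlow (yosida (2 * ω + 1 + k) (R k)) t
  have h1 := h.expFlow_apply_self_le (hle n) (hR n) (x₀ - p.1) ht.1
  have h2 := h.expFlow_apply_self_le (hle k) (hR k) (-(x₀ - p.1)) ht.1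
  have h3 := h.expFlow_sub_apply_self_le (hle n) (hle k) (hR n) (hR k)
    (by simpa using hne) p.1 ht
  have h4 := hN (n, k) ⟨(le_max_left _ _).trans hn, (le_max_right _ _).trans hk⟩
  have h5 : Real.exp (4 * ω * t) ≤ a := Real.exp_le_exp.2 (by nlinarith [ht.2])
  have h6 := h.apply_add_self_le (x (x₀ - p.1) + y (-(x₀ - p.1))) (x p.1 - y p.1)
  have h7 := h.apply_add_self_le (x (x₀ - p.1)) (y (-(x₀ - p.1)))
  have e : x x₀ - y x₀ = x (x₀ - p.1) + y (-(x₀ - p.1)) + (x p.1 - y p.1) := by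
    rw [map_neg, map_sub, map_sub]; abel
  have hneg : B (-(x₀ - p.1)) (-(x₀ - p.1)) = B (x₀ - p.1) (x₀ - p.1) := by
    rw [map_neg, map_neg, neg_apply, neg_neg]
  rw [hneg] at h2
  have h8 : Real.exp (4 * ω * t) * B (x₀ - p.1) (x₀ - p.1) ≤ δ / 16 :=
    calc _ ≤ a * (δ / (16 * a)) :=
          mul_le_mul h5 hxp.le (h.apply_self_nonneg _) ha.le
      _ = δ / 16 := by field_simp
  have h9 := mul_lt_mul_of_pos_left h4 (mul_pos ha hb)
  have h10 : a * b * (δ / (8 * (a * b))) = δ / 8 := by field_simp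
  rw [h10] at h9
  have h11 : B (x x₀ - y x₀) (x x₀ - y x₀) < δ := by
    rw [e]
    dsimp only at h9
    linarith
  rw [dist_eq_norm]
  have h12 := (hcoer (x x₀ - y x₀)).trans_lt h11
  exact lt_of_pow_lt_pow_left₀ 2 hε.le (lt_of_mul_lt_mul_left h12 hm.le)

end IsGenerator

end

/-! ### Existence of mild solutions, and strict solutions for data in the domain. -/

section

variable {E : Type*} [NormedAddCommGroup E] [NormedSpace ℝ E] [CompleteSpace E]
variable {G : Submodule ℝ (E × E)} {B : E →L[ℝ] E →L[ℝ] ℝ} {ω : ℝ}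

namespace IsGenerator

/-- The limit `X` of the Yosida flows is locally uniform, so it is continuous and the integrals `z
n` converge. The pair `(μ R z, A z)` formed with `z = z n` lies in `G` and its second component is
the increment of the flow; both components converge, and `G` is closed. -/
theorem exists_isMild (h : IsGenerator G B ω) (x₀ : E) : ∃ X : ℝ → E, IsMild G x₀ X := by
  have hω := h.nonneg
  have hle : ∀ n : ℕ, 2 * ω + 1 ≤ 2 * ω + 1 + (n : ℝ) := fun n => by
    linarith [(n.cast_nonneg : (0 : ℝ) ≤ n)]
  choose R hR using fun n : ℕ => h.exists_isResolvent (μ := 2 * ω + 1 + n)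
    (by linarith [hle n])
  set A : ℕ → E →L[ℝ] E := fun n => yosida (2 * ω + 1 + n) (R n)
  have hcau := h.yosida_uniformCauchySeqOn hR x₀
  have hex : ∀ t : ℝ, ∃ y, 0 ≤ t → Tendsto (fun n => expFlow (A n) t x₀) atTop (𝓝 y) := by
    intro t
    by_cases ht : 0 ≤ t
    · obtain ⟨y, hy⟩ := cauchySeq_tendsto_of_complete ((hcau t).cauchySeq ⟨ht, le_rfl⟩)
      exact ⟨y, fun _ => hy⟩
    · exact ⟨0, fun h => absurd h ht⟩
  choose X hX using hex
  have hunif : ∀ T, TendstoUniformlyOn (fun n t => expFlow (A n) t x₀) X atTop (Icc 0 T) :=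
    fun T => (hcau T).tendstoUniformlyOn_of_tendsto fun t ht => hX t ht.1
  have hcont : ∀ n, Continuous fun t => expFlow (A n) t x₀ := fun n =>
    continuous_iff_continuousAt.2 fun t => (hasDerivAt_expFlow (A n) x₀ t).continuousAt
  refine ⟨X, fun t ht => ?_, fun t ht => ?_⟩
  · have h1 := (hunif (t + 1)).continuousOn (Frequently.of_forall fun n => (hcont n).continuousOn)
    refine (h1 t ⟨ht, by linarith⟩).mono_of_mem_nhdsWithin ?_
    rw [← Ici_inter_Iic]
    exact inter_mem self_mem_nhdsWithin (mem_nhdsWithin_of_mem_nhds (Iic_mem_nhds (by linarith)))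
  · have hint : Tendsto (fun n => ∫ s in (0 : ℝ)..t, expFlow (A n) s x₀) atTop
        (𝓝 (∫ s in (0 : ℝ)..t, X s)) := by
      refine TendstoUniformlyOn.tendsto_intervalIntegral_of_continuousOn
        (Eventually.of_forall fun n => (hcont n).continuousOn) ?_
      rw [uIcc_of_le ht]
      exact hunif t
    set z : ℕ → E := fun n => ∫ s in (0 : ℝ)..t, expFlow (A n) s x₀
    have hA : ∀ n, A n (z n) = expFlow (A n) t x₀ - x₀ := by
      intro n
      have h1 := (A n).intervalIntegral_comp_comm ((hcont n).intervalIntegrable (μ := volume) 0 t)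
      rw [← h1, intervalIntegral.integral_eq_sub_of_hasDerivAt
        (fun s _ => hasDerivAt_expFlow (A n) x₀ s)
        (((A n).continuous.comp (hcont n)).intervalIntegrable 0 t)]
      simp [expFlow]
    have hJ : Tendsto (fun n : ℕ => (2 * ω + 1 + n) • R n (z n)) atTop
        (𝓝 (∫ s in (0 : ℝ)..t, X s)) := by
      set Z := ∫ s in (0 : ℝ)..t, X s
      have h1 : Tendsto (fun n : ℕ => (2 * ω + 1 + n) • R n (z n - Z)) atTop (𝓝 0) := by
        apply h.tendsto_zero
        have hq : Continuous fun x : E => B (x - Z) (x - Z) := by fun_prop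
        have h2 := ((hq.tendsto _).comp hint).const_mul 4
        rw [sub_self, map_zero, mul_zero] at h2
        exact squeeze_zero (fun n => h.apply_self_nonneg _)
          (fun n => h.smul_resolvent_apply_self_le (hle n) (hR n) _) h2
      have h3 := h1.add (h.tendsto_smul_resolvent hR Z)
      rw [zero_add] at h3
      refine h3.congr fun n => ?_
      rw [map_sub, smul_sub, sub_add_cancel]
    have hlim : Tendsto (fun n : ℕ => ((2 * ω + 1 + n) • R n (z n), A n (z n))) atTop
        (𝓝 (∫ s in (0 : ℝ)..t, X s, X t - x₀)) := by
      refine hJ.prodMk_nhds ?_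
      simp only [hA]
      exact (hX t ht).sub_const x₀
    exact h.isClosed.mem_of_tendsto hlim (Eventually.of_forall fun n => (hR n).yosida_mem (z n))

lemma _root_.DissipativeEvolution.hasDerivWithinAt_integral_Ici {V : ℝ → E}
    (hV : ContinuousOn V (Ici 0)) {t : ℝ} (ht : 0 ≤ t) :
    HasDerivWithinAt (fun s => ∫ u in (0 : ℝ)..s, V u) (V t) (Ici 0) t := by
  have hc : Continuous fun s => V (max 0 s) :=
    hV.comp_continuous (by fun_prop) fun s => mem_Ici.2 (le_max_left _ _)
  have h1 := intervalIntegral.integral_hasDerivAt_right (hc.intervalIntegrable 0 t)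
    (hc.stronglyMeasurableAtFilter _ _) hc.continuousAt
  rw [max_eq_right ht] at h1
  have h2 : ∀ s ∈ Ici (0 : ℝ), ∫ u in (0 : ℝ)..s, V u = ∫ u in (0 : ℝ)..s, V (max 0 u) := by
    intro s hs
    refine intervalIntegral.integral_congr fun u hu => ?_
    rw [uIcc_of_le hs] at hu
    simp only [max_eq_right hu.1]
  exact h1.hasDerivWithinAt.congr h2 (h2 t ht)

/-- A mild solution with data in the domain of the operator is a strict solution. -/
theorem exists_hasDerivWithinAt (h : IsGenerator G B ω) {x₀ y₀ : E} (h₀ : (x₀, y₀) ∈ G)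
    {X : ℝ → E} (hX : IsMild G x₀ X) :
    ∃ V : ℝ → E, ContinuousOn V (Ici 0) ∧ ∀ t, 0 ≤ t → (X t, V t) ∈ G ∧
      HasDerivWithinAt X (V t) (Ici 0) t := by
  -- `V` is the candidate for the derivative: `Z = x₀ + ∫ V` stays in the domain with `𝒜 Z = V`,
  -- because `(Z, V)` is the sum of `(x₀, y₀)` and an element of `G`. Hence `Z` is a mild solution,
  -- and uniqueness identifies it with `X`.
  obtain ⟨V, hV⟩ := h.exists_isMild y₀
  set Z : ℝ → E := fun t => x₀ + ∫ s in (0 : ℝ)..t, V s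
  have hZd : ∀ t, 0 ≤ t → HasDerivWithinAt Z (V t) (Ici 0) t := fun t ht =>
    (hasDerivWithinAt_integral_Ici hV.continuousOn ht).const_add x₀
  have hZc : ContinuousOn Z (Ici 0) := fun t ht => (hZd t ht).continuousWithinAt
  have hZG : ∀ t, 0 ≤ t → (Z t, V t) ∈ G := by
    intro t ht
    convert G.add_mem h₀ (hV.mem t ht) using 1
    ext <;> simp [Z]
  have hZ : IsMild G x₀ Z := by
    refine ⟨hZc, fun t ht => ?_⟩
    have hsub : Icc 0 t ⊆ Ici 0 := fun s hs => hs.1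
    convert integral_mem h.isClosed ht (hZc.mono hsub) (hV.continuousOn.mono hsub)
      (fun s hs => hZG s hs.1) using 2
    simp [Z]
  have hXZ := h.mild_unique hX hZ
  refine ⟨V, hV.continuousOn, fun t ht => ⟨?_, (hZd t ht).congr hXZ (hXZ ht)⟩⟩
  rw [hXZ ht]
  exact hZG t ht

end IsGenerator

end

end DissipativeEvolution

open DissipativeEvolution

namespace DegenerateWave

/-! ### Absolutely continuous functions, the coefficients and the weighted measure. -/

section

/-- `F` is absolutely continuous on `[p, q]` with derivative `f`. -/
def IsPrimitive (F f : ℝ → ℝ) (p q : ℝ) : Prop :=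
  IntervalIntegrable f volume p q ∧ ∀ y ∈ Icc p q, F y = F p + ∫ s in p..y, f s

namespace IsPrimitive

variable {F f G g : ℝ → ℝ} {p q : ℝ}

lemma continuousOn (hF : IsPrimitive F f p q) (hpq : p ≤ q) : ContinuousOn F (Icc p q) := by
  have h1 := intervalIntegral.continuousOn_primitive_interval' hF.1 (left_mem_uIcc)
  rw [uIcc_of_le hpq] at h1
  exact (continuousOn_const.add h1).congr hF.2

lemma integral_eq (hF : IsPrimitive F f p q) (hpq : p ≤ q) :
    ∫ s in p..q, f s = F q - F p := by
  rw [hF.2 q ⟨hpq, le_rfl⟩]; ring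

lemma mono_right (hF : IsPrimitive F f p q) {y : ℝ} (hy : y ∈ Icc p q) : IsPrimitive F f p y :=
  ⟨hF.1.mono_set (uIcc_subset_uIcc_left (by rwa [uIcc_of_le (hy.1.trans hy.2)])),
    fun z hz => hF.2 z ⟨hz.1, hz.2.trans hy.2⟩⟩

lemma intervalIntegrable_mul (hF : IsPrimitive F f p q) (hG : IsPrimitive G g p q) (hpq : p ≤ q) :
    IntervalIntegrable (fun s => f s * G s + F s * g s) volume p q :=
  (hF.1.mul_continuousOn (by rw [uIcc_of_le hpq]; exact hG.continuousOn hpq)).add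
    (hG.1.continuousOn_mul (by rw [uIcc_of_le hpq]; exact hF.continuousOn hpq))

lemma integral_mul (hF : IsPrimitive F f p q) (hG : IsPrimitive G g p q) (hpq : p ≤ q) :
    ∫ s in p..q, (f s * G s + F s * g s) = F q * G q - F p * G p := by
  have hF1 : AbsolutelyContinuousOnInterval (fun y => F p + ∫ s in p..y, f s) p q :=
    (ContDiffOn.absolutelyContinuousOnInterval (f := fun _ => F p) contDiffOn_const).add
      (hF.1.absolutelyContinuousOnInterval_intervalIntegral left_mem_uIcc)
  have hG1 : AbsolutelyContinuousOnInterval (fun y => G p + ∫ s in p..y, g s) p q :=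
    (ContDiffOn.absolutelyContinuousOnInterval (f := fun _ => G p) contDiffOn_const).add
      (hG.1.absolutelyContinuousOnInterval_intervalIntegral left_mem_uIcc)
  have h1 := hF1.integral_deriv_mul_eq_sub hG1
  rw [← hF.2 q ⟨hpq, le_rfl⟩, ← hG.2 q ⟨hpq, le_rfl⟩, intervalIntegral.integral_same,
    intervalIntegral.integral_same, add_zero, add_zero] at h1
  rw [← h1]
  apply intervalIntegral.integral_congr_ae
  filter_upwards [hF.1.ae_hasDerivAt_integral, hG.1.ae_hasDerivAt_integral] with x hx₁ hx₂ hx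
  have hx' : x ∈ uIcc p q := uIoc_subset_uIcc hx
  have d1 := (hx₁ hx' p left_mem_uIcc).const_add (F p)
  have d2 := (hx₂ hx' p left_mem_uIcc).const_add (G p)
  rw [uIcc_of_le hpq] at hx'
  rw [d1.deriv, d2.deriv, ← hF.2 x hx', ← hG.2 x hx']

lemma mul (hF : IsPrimitive F f p q) (hG : IsPrimitive G g p q) (hpq : p ≤ q) :
    IsPrimitive (fun s => F s * G s) (fun s => f s * G s + F s * g s) p q := by
  refine ⟨hF.intervalIntegrable_mul hG hpq, fun y hy => ?_⟩
  rw [(hF.mono_right hy).integral_mul (hG.mono_right hy) hy.1]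
  ring

/-- Lebesgue differentiation: almost everywhere `f` is the derivative of its primitive, which is
locally constant here. -/
lemma ae_eq_zero_of_const (hF : IsPrimitive F f p q) (hpq : p ≤ q)
    (h : ∀ x ∈ Ioo p q, F x = F p) : ∀ᵐ x, x ∈ Ioo p q → f x = 0 := by
  filter_upwards [hF.1.ae_hasDerivAt_integral] with x hx hxI
  have h1 := hx (by rw [uIcc_of_le hpq]; exact Ioo_subset_Icc_self hxI) p left_mem_uIcc
  have h2 : (fun x => ∫ t in p..x, f t) =ᶠ[𝓝 x] fun _ => 0 := by
    filter_upwards [Ioo_mem_nhds hxI.1 hxI.2] with y hy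
    have := hF.2 y (Ioo_subset_Icc_self hy)
    rw [h y hy] at this
    linarith
  exact (h1.congr_of_eventuallyEq h2.symm).unique (hasDerivAt_const x 0)

end IsPrimitive

variable {a b : ℝ → ℝ} {K : ℝ}

lemma eta_pos (x : ℝ) : 0 < eta a b x := Real.exp_pos _

namespace CoeffHyp

lemma intervalIntegrable_div (h : CoeffHyp a b K) :
    IntervalIntegrable (fun x => b x / a x) volume 0 1 := by
  rw [intervalIntegrable_iff_integrableOn_Ioo_of_le zero_le_one]
  exact h.integrable_div

lemma continuousOn_eta (h : CoeffHyp a b K) : ContinuousOn (eta a b) (Icc 0 1) := by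
  have h1 := intervalIntegral.continuousOn_primitive_interval' h.intervalIntegrable_div
    (a := 1 / 2) (by rw [uIcc_of_le zero_le_one]; norm_num)
  rw [uIcc_of_le zero_le_one] at h1
  exact h1.rexp

lemma exists_eta_bounds (h : CoeffHyp a b K) :
    ∃ m M : ℝ, 0 < m ∧ 0 < M ∧ ∀ x ∈ Icc (0 : ℝ) 1, m ≤ eta a b x ∧ eta a b x ≤ M := by
  obtain ⟨x₁, _, h1⟩ := isCompact_Icc.exists_isMinOn (nonempty_Icc.2 zero_le_one)
    h.continuousOn_eta
  obtain ⟨x₂, _, h2⟩ := isCompact_Icc.exists_isMaxOn (nonempty_Icc.2 zero_le_one)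
    h.continuousOn_eta
  exact ⟨_, _, eta_pos x₁, eta_pos x₂, fun x hx => ⟨h1 hx, h2 hx⟩⟩

lemma hasDerivAt_eta_inv (h : CoeffHyp a b K) {x : ℝ} (hx : x ∈ Ioo (0 : ℝ) 1) :
    HasDerivAt (fun y => (eta a b y)⁻¹) (-(b x / a x) * (eta a b x)⁻¹) x := by
  have hI : Icc (0 : ℝ) 1 ∈ 𝓝 x := Icc_mem_nhds hx.1 hx.2
  have hc : ContinuousAt (fun x => b x / a x) x :=
    (h.continuousOn_b.continuousAt hI).div (h.continuousOn_a.continuousAt hI)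
      (h.a_pos x ⟨hx.1, hx.2.le⟩).ne'
  have hcont : ContinuousOn (fun x => b x / a x) (Ioo 0 1) := fun y hy =>
    ((h.continuousOn_b.continuousAt (Icc_mem_nhds hy.1 hy.2)).div
      (h.continuousOn_a.continuousAt (Icc_mem_nhds hy.1 hy.2))
      (h.a_pos y ⟨hy.1, hy.2.le⟩).ne').continuousWithinAt
  have hint : IntervalIntegrable (fun x => b x / a x) volume (1 / 2) x :=
    h.intervalIntegrable_div.mono_set (by
      rw [uIcc_of_le zero_le_one]
      exact uIcc_subset_Icc (by norm_num) (Ioo_subset_Icc_self hx))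
  have h1 := intervalIntegral.integral_hasDerivAt_right hint
    (hcont.stronglyMeasurableAtFilter isOpen_Ioo x hx) hc
  have h2 := h1.neg.exp
  have e : (fun y => (eta a b y)⁻¹) =
      fun y => Real.exp ((-fun u => ∫ x in (1 / 2 : ℝ)..u, b x / a x) y) := by
    funext y
    rw [eta, ← Real.exp_neg]; rfl
  rw [e]
  convert! h2 using 1
  rw [Pi.neg_apply, Real.exp_neg, mul_comm]; rfl

/-- Needed to differentiate `u' = (flux) · η⁻¹` by the product rule. The derivative is used only in
the open interval, with continuity up to `1`, as nothing is known about `b / a` beyond `1`. -/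
lemma isPrimitive_eta_inv (h : CoeffHyp a b K) {x : ℝ} (hx : x ∈ Ioc (0 : ℝ) 1) :
    IsPrimitive (fun y => (eta a b y)⁻¹) (fun y => -(b y / a y) * (eta a b y)⁻¹) x 1 := by
  have hsub : Icc x 1 ⊆ Icc 0 1 := Icc_subset_Icc_left hx.1.le
  have hce : ContinuousOn (fun y => (eta a b y)⁻¹) (Icc x 1) :=
    (h.continuousOn_eta.mono hsub).inv₀ fun y _ => (eta_pos y).ne'
  have hc : ContinuousOn (fun y => -(b y / a y) * (eta a b y)⁻¹) (Icc x 1) :=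
    ((h.continuousOn_b.mono hsub).div (h.continuousOn_a.mono hsub)
      fun y hy => (h.a_pos y ⟨hx.1.trans_le hy.1, hy.2⟩).ne').neg.mul hce
  refine ⟨(by rw [uIcc_of_le hx.2]; exact hc : ContinuousOn _ _).intervalIntegrable,
    fun y hy => ?_⟩
  rw [intervalIntegral.integral_eq_sub_of_hasDerivAt_of_le hy.1
    (hce.mono (Icc_subset_Icc_right hy.2))
    (fun z hz => h.hasDerivAt_eta_inv ⟨hx.1.trans hz.1, hz.2.trans_le hy.2⟩)
    (ContinuousOn.intervalIntegrable
      (by rw [uIcc_of_le hy.1]; exact hc.mono (Icc_subset_Icc_right hy.2)))]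
  ring

lemma sigma_pos (h : CoeffHyp a b K) {x : ℝ} (hx : x ∈ Ioc (0 : ℝ) 1) : 0 < sigma a b x :=
  div_pos (h.a_pos x hx) (eta_pos x)

lemma continuousOn_sigma (h : CoeffHyp a b K) : ContinuousOn (sigma a b) (Icc 0 1) :=
  h.continuousOn_a.div h.continuousOn_eta fun x _ => (eta_pos x).ne'

lemma continuousOn_one_div_sigma (h : CoeffHyp a b K) :
    ContinuousOn (fun x => 1 / sigma a b x) (Ioc 0 1) :=
  continuousOn_const.div (h.continuousOn_sigma.mono Ioc_subset_Icc_self)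
    fun _ hx => (h.sigma_pos hx).ne'

lemma aemeasurable_weight (h : CoeffHyp a b K) :
    AEMeasurable (fun x => ENNReal.ofReal (1 / sigma a b x)) unitMeasure :=
  ((h.continuousOn_one_div_sigma.mono Ioo_subset_Ioc_self).aemeasurable
    measurableSet_Ioo).ennreal_ofReal

lemma unitMeasure_absolutelyContinuous (h : CoeffHyp a b K) :
    unitMeasure ≪ weightMeasure a b := by
  refine withDensity_absolutelyContinuous' h.aemeasurable_weight ?_
  filter_upwards [ae_restrict_mem measurableSet_Ioo] with x hx
  have := h.sigma_pos (Ioo_subset_Ioc_self hx)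
  simpa using this

lemma toReal_weight (h : CoeffHyp a b K) :
    ∀ᵐ x ∂unitMeasure, (ENNReal.ofReal (1 / sigma a b x)).toReal = 1 / sigma a b x := by
  filter_upwards [ae_restrict_mem measurableSet_Ioo] with x hx
  exact ENNReal.toReal_ofReal (one_div_pos.2 (h.sigma_pos (Ioo_subset_Ioc_self hx))).le

lemma integrable_weight_iff (h : CoeffHyp a b K) {g : ℝ → ℝ} :
    Integrable g (weightMeasure a b) ↔ Integrable (fun x => g x / sigma a b x) unitMeasure := by
  rw [weightMeasure, integrable_withDensity_iff_integrable_smul₀' h.aemeasurable_weight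
    (Eventually.of_forall fun x => ENNReal.ofReal_lt_top)]
  refine integrable_congr ?_
  filter_upwards [h.toReal_weight] with x hx
  rw [hx, smul_eq_mul, one_div, div_eq_inv_mul]

lemma integral_weight (h : CoeffHyp a b K) (g : ℝ → ℝ) :
    ∫ x, g x ∂(weightMeasure a b) = ∫ x, g x / sigma a b x ∂unitMeasure := by
  rw [weightMeasure, integral_withDensity_eq_integral_toReal_smul₀ h.aemeasurable_weight
    (Eventually.of_forall fun x => ENNReal.ofReal_lt_top)]
  refine integral_congr_ae ?_
  filter_upwards [h.toReal_weight] with x hx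
  rw [hx, smul_eq_mul, one_div, div_eq_inv_mul]

/-- The weight `1/σ` can blow up only at `0`. Finiteness away from `0` makes `L²_{1/σ}` functions
integrable against `dx / σ` there, so that the flux is defined on `(0,1]`. -/
lemma weightMeasure_Ioo_lt_top (h : CoeffHyp a b K) {x : ℝ} (hx : x ∈ Ioc (0 : ℝ) 1) :
    weightMeasure a b (Ioo x 1) < ⊤ := by
  have hsub : Ioo x 1 ⊆ Ioo 0 1 := Ioo_subset_Ioo_left hx.1.le
  rw [weightMeasure, withDensity_apply _ measurableSet_Ioo,
    Measure.restrict_restrict measurableSet_Ioo, inter_eq_left.2 hsub]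
  have h1 : IntegrableOn (fun x => 1 / sigma a b x) (Icc x 1) :=
    (h.continuousOn_one_div_sigma.mono
      fun y hy => ⟨hx.1.trans_le hy.1, hy.2⟩).integrableOn_compact isCompact_Icc
  exact (h1.mono_set Ioo_subset_Icc_self).lintegral_lt_top

lemma intervalIntegrable_div_sigma (h : CoeffHyp a b K) (f : L2w a b) {x : ℝ}
    (hx : x ∈ Ioc (0 : ℝ) 1) : IntervalIntegrable (fun s => f s / sigma a b s) volume x 1 := by
  have hsub : Ioo x 1 ⊆ Ioo 0 1 := Ioo_subset_Ioo_left hx.1.le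
  have : IsFiniteMeasure ((weightMeasure a b).restrict (Ioo x 1)) :=
    ⟨by simpa using h.weightMeasure_Ioo_lt_top hx⟩
  have h1 : Integrable f ((weightMeasure a b).restrict (Ioo x 1)) :=
    ((Lp.memLp f).restrict _).integrable (by norm_num)
  have h2 : Integrable ((Ioo x 1).indicator f) (weightMeasure a b) :=
    (integrable_indicator_iff measurableSet_Ioo).2 h1
  rw [h.integrable_weight_iff] at h2
  rw [intervalIntegrable_iff_integrableOn_Ioo_of_le hx.2]
  have h3 : IntegrableOn (fun s => (Ioo x 1).indicator f s / sigma a b s) (Ioo x 1) :=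
    IntegrableOn.mono_set (s := Ioo x 1) h2 hsub
  refine h3.congr_fun (fun s hs => ?_) measurableSet_Ioo
  simp [indicator_of_mem hs]

lemma inner_eq (h : CoeffHyp a b K) (f g : L2w a b) :
    inner ℝ f g = ∫ x, f x * g x / sigma a b x ∂unitMeasure := by
  rw [L2.inner_def, ← h.integral_weight]
  refine integral_congr_ae (Eventually.of_forall fun x => ?_)
  simp [mul_comm]

lemma integrable_inner (h : CoeffHyp a b K) (f g : L2w a b) :
    Integrable (fun x => f x * g x / sigma a b x) unitMeasure := by
  rw [← h.integrable_weight_iff (g := fun x => f x * g x)]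
  exact (Lp.memLp f).integrable_mul (Lp.memLp g)

end CoeffHyp

end

/-! ### Point values, the flux, and integration by parts up to the degenerate end. -/

section

variable {a b : ℝ → ℝ} {K : ℝ}

/-- The inclusion `H¹_{1/σ,0} → L²_{1/σ}` as a continuous linear map. -/
noncomputable def toL2wL (a b : ℝ → ℝ) : H1Zero a b →L[ℝ] L2w a b :=
  (ContinuousLinearMap.fst ℝ _ _).comp
    ((WithLp.prodContinuousLinearEquiv 2 ℝ (L2w a b) L2unit).toContinuousLinearMap.comp
      (H1Zero a b).subtypeL)

/-- The derivative `H¹_{1/σ,0} → L²` as a continuous linear map. -/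
noncomputable def dxL (a b : ℝ → ℝ) : H1Zero a b →L[ℝ] L2unit :=
  (ContinuousLinearMap.snd ℝ _ _).comp
    ((WithLp.prodContinuousLinearEquiv 2 ℝ (L2w a b) L2unit).toContinuousLinearMap.comp
      (H1Zero a b).subtypeL)

@[simp] lemma toL2wL_apply (u : H1Zero a b) : toL2wL a b u = toL2w u := rfl

@[simp] lemma dxL_apply (u : H1Zero a b) : dxL a b u = dx u := rfl

lemma norm_sq_eq (u : H1Zero a b) : ‖u‖ ^ 2 = ‖toL2w u‖ ^ 2 + ‖dx u‖ ^ 2 := by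
  rw [Submodule.coe_norm, WithLp.prod_norm_sq_eq_of_L2]; rfl

lemma h1Zero_ext {u v : H1Zero a b} (h1 : toL2w u = toL2w v) (h2 : dx u = dx v) : u = v := by
  apply Subtype.ext
  apply WithLp.ofLp_injective
  exact Prod.ext h1 h2

lemma inner_unit (φ ψ : L2unit) : inner ℝ φ ψ = ∫ x, φ x * ψ x ∂unitMeasure := by
  rw [L2.inner_def]
  refine integral_congr_ae (Eventually.of_forall fun x => ?_)
  simp [mul_comm]

lemma integrable_mul_unit (φ ψ : L2unit) : Integrable (fun x => φ x * ψ x) unitMeasure :=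
  (Lp.memLp φ).integrable_mul (Lp.memLp ψ)

lemma intervalIntegrable_unit {g : ℝ → ℝ} (hg : Integrable g unitMeasure) {x y : ℝ}
    (hx : x ∈ Icc (0 : ℝ) 1) (hy : y ∈ Icc (0 : ℝ) 1) : IntervalIntegrable g volume x y := by
  have : IntervalIntegrable g volume 0 1 := by
    rw [intervalIntegrable_iff_integrableOn_Ioo_of_le zero_le_one]
    exact hg
  exact this.mono_set (by rw [uIcc_of_le zero_le_one]; exact uIcc_subset_Icc hx hy)

lemma integral_unit_eq (g : ℝ → ℝ) : ∫ x, g x ∂unitMeasure = ∫ x in (0 : ℝ)..1, g x := by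
  rw [intervalIntegral.integral_of_le zero_le_one, integral_Ioc_eq_integral_Ioo]

lemma integrable_L2unit (φ : L2unit) : Integrable φ unitMeasure :=
  (Lp.memLp φ).integrable (by norm_num)

lemma isPrimitive_primitive {g : ℝ → ℝ} (hg : Integrable g unitMeasure) {x : ℝ}
    (hx : x ∈ Icc (0 : ℝ) 1) : IsPrimitive (fun y => ∫ s in (0 : ℝ)..y, g s) g x 1 := by
  refine ⟨intervalIntegrable_unit hg hx (by simp), fun y hy => ?_⟩
  rw [intervalIntegral.integral_add_adjacent_intervals]
  · exact intervalIntegrable_unit hg (by simp) hx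
  · exact intervalIntegrable_unit hg hx ⟨hx.1.trans hy.1, hy.2⟩

lemma isPrimitive_val (u : H1Zero a b) {x : ℝ} (hx : x ∈ Icc (0 : ℝ) 1) :
    IsPrimitive (val u) (dx u) x 1 :=
  isPrimitive_primitive (integrable_L2unit _) hx

lemma CoeffHyp.toL2w_ae (h : CoeffHyp a b K) (u : H1Zero a b) :
    ∀ᵐ x ∂unitMeasure, toL2w u x = val u x :=
  h.unitMeasure_absolutelyContinuous.ae_le u.2

/-- Cauchy–Schwarz against the indicator of `(0, x)`, whose norm is `√x`. The factor `x` is what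
later kills the boundary term at `0`. -/
lemma primitive_sq_le (φ : L2unit) {x : ℝ} (hx : x ∈ Icc (0 : ℝ) 1) :
    (∫ s in (0 : ℝ)..x, φ s) ^ 2 ≤ x * ‖φ‖ ^ 2 := by
  have hsub : Ioo 0 x ⊆ Ioo (0 : ℝ) 1 := Ioo_subset_Ioo_right hx.2
  have hm : unitMeasure.real (Ioo 0 x) = x := by
    rw [Measure.real, Measure.restrict_apply measurableSet_Ioo, inter_eq_left.2 hsub]
    simp [hx.1]
  have h1 : ∫ s in (0 : ℝ)..x, φ s = inner ℝ (indicatorConstLp 2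
      (measurableSet_Ioo (a := (0 : ℝ)) (b := x)) (measure_ne_top unitMeasure _) (1 : ℝ)) φ := by
    rw [L2.inner_indicatorConstLp_one, Measure.restrict_restrict measurableSet_Ioo,
      inter_eq_left.2 hsub, intervalIntegral.integral_of_le hx.1, integral_Ioc_eq_integral_Ioo]
  have h2 := abs_real_inner_le_norm (indicatorConstLp 2
      (measurableSet_Ioo (a := (0 : ℝ)) (b := x)) (measure_ne_top unitMeasure _) (1 : ℝ)) φ
  rw [← h1, norm_indicatorConstLp (by norm_num) (by norm_num), hm] at h2
  have h3 : x ^ (1 / ENNReal.toReal 2) = Real.sqrt x := by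
    rw [Real.sqrt_eq_rpow]; norm_num
  rw [h3, norm_one, one_mul] at h2
  calc (∫ s in (0 : ℝ)..x, φ s) ^ 2 = |∫ s in (0 : ℝ)..x, φ s| ^ 2 := (sq_abs _).symm
    _ ≤ (Real.sqrt x * ‖φ‖) ^ 2 := by gcongr
    _ = x * ‖φ‖ ^ 2 := by rw [mul_pow, Real.sq_sqrt hx.1]

lemma val_sq_le (u : H1Zero a b) {x : ℝ} (hx : x ∈ Icc (0 : ℝ) 1) :
    val u x ^ 2 ≤ x * ‖dx u‖ ^ 2 :=
  primitive_sq_le (dx u) hx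

/-- The trace `u ↦ u(1)` as a continuous linear functional. -/
noncomputable def traceL (a b : ℝ → ℝ) : H1Zero a b →L[ℝ] ℝ :=
  (innerSL ℝ (indicatorConstLp 2 (measurableSet_Ioo (a := (0 : ℝ)) (b := 1))
    (measure_ne_top unitMeasure _) (1 : ℝ))).comp (dxL a b)

@[simp] lemma traceL_apply (u : H1Zero a b) : traceL a b u = val u 1 := by
  rw [traceL, ContinuousLinearMap.comp_apply, innerSL_apply_apply, L2.inner_indicatorConstLp_one,
    Measure.restrict_restrict measurableSet_Ioo, inter_self, ← integral_Ioc_eq_integral_Ioo,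
    ← intervalIntegral.integral_of_le zero_le_one]
  rfl

namespace CoeffHyp

lemma memLp_eta (h : CoeffHyp a b K) : MemLp (eta a b) ⊤ unitMeasure := by
  obtain ⟨m, M, _, _, hmM⟩ := h.exists_eta_bounds
  refine memLp_top_of_bound ((h.continuousOn_eta.mono Ioo_subset_Icc_self).aestronglyMeasurable
    measurableSet_Ioo) M ?_
  filter_upwards [ae_restrict_mem measurableSet_Ioo] with x hx
  rw [Real.norm_of_nonneg (eta_pos x).le]
  exact (hmM x (Ioo_subset_Icc_self hx)).2

/-- Multiplication by `η` on `L²(0,1)`. -/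
noncomputable def etaMul (h : CoeffHyp a b K) : L2unit →L[ℝ] L2unit :=
  (ContinuousLinearMap.mul ℝ ℝ).holderL unitMeasure ⊤ 2 2 (h.memLp_eta.toLp _)

lemma etaMul_ae (h : CoeffHyp a b K) (φ : L2unit) :
    ∀ᵐ x ∂unitMeasure, h.etaMul φ x = eta a b x * φ x := by
  have h1 := (ContinuousLinearMap.mul ℝ ℝ).coeFn_holder (r := 2) (h.memLp_eta.toLp _) φ
  filter_upwards [h1, h.memLp_eta.coeFn_toLp] with x hx hx2
  rw [hx2] at hx
  exact hx

/-- The bilinear form `∫ η φ ψ` on `L²(0,1)`. -/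
noncomputable def etaForm (h : CoeffHyp a b K) : L2unit →L[ℝ] L2unit →L[ℝ] ℝ :=
  (innerSL ℝ : L2unit →L[ℝ] L2unit →L[ℝ] ℝ).comp h.etaMul

lemma etaForm_apply (h : CoeffHyp a b K) (φ ψ : L2unit) :
    h.etaForm φ ψ = ∫ x, eta a b x * φ x * ψ x ∂unitMeasure := by
  change inner ℝ (h.etaMul φ) ψ = _
  rw [inner_unit]
  refine integral_congr_ae ?_
  filter_upwards [h.etaMul_ae φ] with x hx
  rw [hx]

lemma integrable_etaForm (h : CoeffHyp a b K) (φ ψ : L2unit) :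
    Integrable (fun x => eta a b x * φ x * ψ x) unitMeasure := by
  refine (integrable_mul_unit (h.etaMul φ) ψ).congr ?_
  filter_upwards [h.etaMul_ae φ] with x hx
  rw [hx]

lemma etaForm_symm (h : CoeffHyp a b K) (φ ψ : L2unit) : h.etaForm φ ψ = h.etaForm ψ φ := by
  simp only [etaForm_apply]
  congr 1 with x
  ring

lemma etaForm_bounds (h : CoeffHyp a b K) {m M : ℝ}
    (hmM : ∀ x ∈ Icc (0 : ℝ) 1, m ≤ eta a b x ∧ eta a b x ≤ M) (φ : L2unit) :
    m * ‖φ‖ ^ 2 ≤ h.etaForm φ φ ∧ h.etaForm φ φ ≤ M * ‖φ‖ ^ 2 := by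
  rw [← real_inner_self_eq_norm_sq, inner_unit, ← integral_const_mul, ← integral_const_mul,
    etaForm_apply]
  constructor
  · refine integral_mono_ae ((integrable_mul_unit φ φ).const_mul _) (h.integrable_etaForm φ φ) ?_
    filter_upwards [ae_restrict_mem measurableSet_Ioo] with x hx
    have := (hmM x (Ioo_subset_Icc_self hx)).1
    nlinarith [mul_self_nonneg (φ x)]
  · refine integral_mono_ae (h.integrable_etaForm φ φ) ((integrable_mul_unit φ φ).const_mul _) ?_
    filter_upwards [ae_restrict_mem measurableSet_Ioo] with x hx
    have := (hmM x (Ioo_subset_Icc_self hx)).2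
    nlinarith [mul_self_nonneg (φ x)]

/-- The flux `c - ∫_x^1 f/σ` is a primitive of `f/σ`. -/
lemma isPrimitive_flux (h : CoeffHyp a b K) (f : L2w a b) (c : ℝ) {x : ℝ}
    (hx : x ∈ Ioc (0 : ℝ) 1) :
    IsPrimitive (fun y => c - ∫ s in y..1, f s / sigma a b s) (fun s => f s / sigma a b s) x 1 := by
  have hi := h.intervalIntegrable_div_sigma f hx
  refine ⟨hi, fun y hy => ?_⟩
  have h1 : y ∈ uIcc x 1 := by rwa [uIcc_of_le hx.2]
  dsimp only
  rw [← intervalIntegral.integral_add_adjacent_intervals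
    (hi.mono_set (uIcc_subset_uIcc_left h1)) (hi.mono_set (uIcc_subset_uIcc_right h1))]
  ring

lemma integrable_weakForm (h : CoeffHyp a b K) (u w : H1Zero a b) (f : L2w a b) :
    Integrable (fun s => f s * toL2w w s / sigma a b s + eta a b s * dx u s * dx w s)
      unitMeasure :=
  (h.integrable_inner f (toL2w w)).add (h.integrable_etaForm _ _)

lemma flux_mul_val (h : CoeffHyp a b K) {u : H1Zero a b} {f : L2w a b} {c : ℝ}
    (hu : HasOp u f c) (w : H1Zero a b) {x : ℝ} (hx : x ∈ Ioc (0 : ℝ) 1) :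
    (c - ∫ s in x..1, f s / sigma a b s) * val w x = c * val w 1 -
      ∫ s in x..1, (f s * toL2w w s / sigma a b s + eta a b s * dx u s * dx w s) := by
  have h1 := (h.isPrimitive_flux f c hx).integral_mul
    (isPrimitive_val w (Ioc_subset_Icc_self hx)) hx.2
  rw [intervalIntegral.integral_same, sub_zero] at h1
  have h2 : ∫ s in x..1, (f s * toL2w w s / sigma a b s + eta a b s * dx u s * dx w s) =
      ∫ s in x..1, (f s / sigma a b s * val w s +
        (c - ∫ r in s..1, f r / sigma a b r) * dx w s) := by
    rw [intervalIntegral.integral_of_le hx.2, intervalIntegral.integral_of_le hx.2,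
      integral_Ioc_eq_integral_Ioo, integral_Ioc_eq_integral_Ioo]
    refine integral_congr_ae ?_
    have hsub : Ioo x 1 ⊆ Ioo 0 1 := Ioo_subset_Ioo_left hx.1.le
    filter_upwards [ae_restrict_of_ae_restrict_of_subset hsub hu,
      ae_restrict_of_ae_restrict_of_subset hsub (h.toL2w_ae w)] with s hs1 hs2
    rw [hs1, hs2]; ring
  rw [h2, h1]; ring

/-- Integration by parts on `[x, 1]` shows that `flux · w` has a limit `L` at `0`, and the claim is
`L = 0`. Otherwise `w(x)² ≤ x ‖w'‖²` gives `1/x ≤ N flux(x)²` near `0`; since the flux equals `η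
u'`, which is in `L²`, this would make `1/x` integrable at `0`. -/
lemma weak_of_hasOp (h : CoeffHyp a b K) {u : H1Zero a b} {f : L2w a b} {c : ℝ}
    (hu : HasOp u f c) (w : H1Zero a b) :
    h.etaForm (dx u) (dx w) + inner ℝ f (toL2w w) = c * val w 1 := by
  set k := fun s => f s * toL2w w s / sigma a b s + eta a b s * dx u s * dx w s with hk
  have hki : Integrable k unitMeasure := h.integrable_weakForm u w f
  have hsum : h.etaForm (dx u) (dx w) + inner ℝ f (toL2w w) = ∫ s in (0 : ℝ)..1, k s := by
    rw [h.etaForm_apply, h.inner_eq, ← integral_unit_eq, hk,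
      integral_add (h.integrable_inner f (toL2w w)) (h.integrable_etaForm _ _), add_comm]
  set flux := fun x => c - ∫ s in x..1, f s / sigma a b s with hflux
  set L := c * val w 1 - ∫ s in (0 : ℝ)..1, k s with hL
  have hlim : Tendsto (fun x => flux x * val w x) (𝓝[>] 0) (𝓝 L) := by
    have h1 : ContinuousOn (fun x => ∫ s in x..1, k s) (Icc 0 1) := by
      have h2 := intervalIntegral.continuousOn_primitive_interval' (a := 1)
        (intervalIntegrable_unit hki (x := 0) (y := 1) (by simp) (by simp)) (by simp)
      rw [uIcc_of_le zero_le_one] at h2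
      exact h2.neg.congr fun x _ => intervalIntegral.integral_symm _ _
    have h3 := (h1 0 (by simp)).mono_left
      (nhdsWithin_mono 0 (Ioc_subset_Icc_self (a := (0 : ℝ)) (b := 1)))
    rw [nhdsWithin_Ioc_eq_nhdsGT zero_lt_one] at h3
    refine (tendsto_const_nhds.sub h3).congr' ?_
    filter_upwards [Ioc_mem_nhdsGT (zero_lt_one' ℝ)] with x hx
    exact (h.flux_mul_val hu w hx).symm
  suffices L = 0 by rw [hsum]; linarith
  by_contra hL0
  have hev : ∀ᶠ x in 𝓝[>] (0 : ℝ), L ^ 2 / 4 ≤ (flux x * val w x) ^ 2 := by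
    have h1 := hlim.pow 2
    have h2 : L ^ 2 / 4 < L ^ 2 := by
      have : 0 < L ^ 2 := by positivity
      linarith
    exact (h1.eventually_const_lt h2).mono fun _ hx => hx.le
  obtain ⟨δ, hδ, hδ'⟩ := mem_nhdsGT_iff_exists_Ioo_subset.1
    (inter_mem hev (Ioc_mem_nhdsGT (zero_lt_one' ℝ)))
  have hδ0 : (0 : ℝ) < δ := hδ
  set N := ‖dx w‖ ^ 2 * 4 / L ^ 2 with hN
  have hbound : ∀ x ∈ Ioo 0 δ, x⁻¹ ≤ N * flux x ^ 2 := by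
    intro x hx
    obtain ⟨h1, h2⟩ := hδ' hx
    have h3 := val_sq_le w (Ioc_subset_Icc_self h2)
    have h4 : L ^ 2 / 4 ≤ flux x ^ 2 * (x * ‖dx w‖ ^ 2) := by
      refine (show L ^ 2 / 4 ≤ _ from h1).trans ?_
      rw [mul_pow]
      exact mul_le_mul_of_nonneg_left h3 (sq_nonneg _)
    rw [inv_le_iff_one_le_mul₀ hx.1, hN, div_mul_eq_mul_div, div_mul_eq_mul_div,
      one_le_div (by positivity)]
    linarith
  -- Only `(0, δ) ⊆ (0, 1]` is known so far. A point `x ≥ 1` of `(0, δ)` is excluded because the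
  -- midpoint of `x` and `δ` would exceed `1`.
  have hsub : Ioo 0 δ ⊆ Ioo 0 1 := by
    intro x hx
    refine ⟨hx.1, ?_⟩
    by_contra hc
    push Not at hc
    have := (hδ' ⟨show 0 < (x + δ) / 2 by linarith [hx.1],
      show (x + δ) / 2 < δ by linarith [hx.2]⟩).2.2
    linarith [hx.2]
  have hint : IntegrableOn (fun x => x⁻¹) (Ioo 0 δ) := by
    have h1 : IntegrableOn (fun x => N * (h.etaMul (dx u) x * h.etaMul (dx u) x)) (Ioo 0 δ) :=
      IntegrableOn.mono_set (s := Ioo 0 δ) ((integrable_mul_unit _ _).const_mul N) hsub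
    refine Integrable.mono' h1 (measurable_inv.aestronglyMeasurable) ?_
    filter_upwards [ae_restrict_of_ae_restrict_of_subset hsub hu,
      ae_restrict_of_ae_restrict_of_subset hsub (h.etaMul_ae (dx u)),
      ae_restrict_mem measurableSet_Ioo] with x h1 h2 h3
    rw [h2, h1, Real.norm_of_nonneg (inv_nonneg.2 h3.1.le), ← sq]
    exact hbound x h3
  rw [← intervalIntegrable_iff_integrableOn_Ioo_of_le hδ0.le, intervalIntegrable_inv_iff] at hint
  rcases hint with h1 | h1
  · exact hδ0.ne h1
  · exact h1 left_mem_uIcc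

end CoeffHyp

end

/-! ### From the weak form back to `HasOp`; single-valuedness. -/

section

variable {a b : ℝ → ℝ} {K : ℝ}

lemma ae_unit_of_forall_Ioo {P : ℝ → Prop}
    (hP : ∀ ε ∈ Ioo (0 : ℝ) 1, ∀ᵐ x, x ∈ Ioo ε 1 → P x) : ∀ᵐ x ∂unitMeasure, P x := by
  rw [ae_restrict_iff' measurableSet_Ioo]
  have h1 : ∀ᵐ x : ℝ, ∀ n : ℕ, x ∈ Ioo (1 / ((n : ℝ) + 2)) 1 → P x := ae_all_iff.2 fun n =>
    hP _ ⟨by positivity, by rw [div_lt_one (by positivity)]; linarith [(n.cast_nonneg : (0:ℝ) ≤ n)]⟩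
  filter_upwards [h1] with x hx hxI
  obtain ⟨n, hn⟩ := exists_nat_one_div_lt hxI.1
  refine hx n ⟨lt_of_le_of_lt ?_ hn, hxI.2⟩
  gcongr
  norm_num

lemma val_eq_zero_of_ae {w : ℝ → ℝ} {ε : ℝ} (hε : ε ∈ Ioo (0 : ℝ) 1)
    (hw : ∀ᵐ x ∂unitMeasure, x ≤ ε → w x = 0) {x : ℝ} (hx : x ∈ Icc 0 ε) :
    ∫ s in (0 : ℝ)..x, w s = 0 := by
  refine intervalIntegral.integral_zero_ae ?_
  rw [ae_restrict_iff' measurableSet_Ioo] at hw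
  filter_upwards [hw] with s hs hsx
  rw [uIoc_of_le hx.1] at hsx
  exact hs ⟨hsx.1, (hsx.2.trans hx.2).trans_lt hε.2⟩ (hsx.2.trans hx.2)

namespace CoeffHyp

/-- A function in `L²(0,1)` that vanishes near `0` is the derivative of a function in
`H¹_{1/σ,0}`. -/
lemma exists_dx_eq (h : CoeffHyp a b K) (φ : L2unit) {ε : ℝ} (hε : ε ∈ Ioo (0 : ℝ) 1)
    (hφ : ∀ᵐ x ∂unitMeasure, x ≤ ε → φ x = 0) : ∃ w : H1Zero a b, dx w = φ := by
  set W := fun x => ∫ s in (0 : ℝ)..x, φ s with hW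
  have hcont : ContinuousOn W (Icc 0 1) :=
    (isPrimitive_primitive (integrable_L2unit φ) (by simp)).continuousOn zero_le_one
  have hfin : IsFiniteMeasure ((weightMeasure a b).restrict (Ioo ε 1)) :=
    ⟨by simpa using h.weightMeasure_Ioo_lt_top (Ioo_subset_Ioc_self hε)⟩
  have h1 : MemLp ((Ioo ε 1).indicator W) 2 (weightMeasure a b) := by
    rw [memLp_indicator_iff_restrict measurableSet_Ioo]
    refine MemLp.of_bound ((hcont.mono fun x hx =>
      ⟨(hε.1.trans hx.1).le, hx.2.le⟩).aestronglyMeasurable measurableSet_Ioo) ‖φ‖ ?_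
    filter_upwards [ae_restrict_mem measurableSet_Ioo] with x hx
    have h2 := primitive_sq_le φ (x := x) ⟨(hε.1.trans hx.1).le, hx.2.le⟩
    refine abs_le_of_sq_le_sq (h2.trans ?_) (norm_nonneg _)
    nlinarith [sq_nonneg ‖φ‖, hx.2]
  -- The primitive vanishes on `[0, ε]`, so however singular `1/σ` is at `0`, it does not matter.
  have h2 : MemLp W 2 (weightMeasure a b) := by
    refine h1.ae_eq ?_
    filter_upwards [ae_weight_mem a b] with x hx
    by_cases hxε : x ∈ Ioo ε 1
    · rw [indicator_of_mem hxε]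
    · rw [indicator_of_notMem hxε]
      have : x ≤ ε := by
        by_contra hc
        exact hxε ⟨not_le.1 hc, hx.2⟩
      exact (val_eq_zero_of_ae hε hφ ⟨hx.1.le, this⟩).symm
  exact ⟨⟨WithLp.toLp 2 (h2.toLp W, φ), h2.coeFn_toLp⟩, rfl⟩

/-- The test function is the one with `w' = η u' - flux` on `(ε, 1)` and `w' = 0` before `ε`.
Subtracting the integration by parts for the flux from the weak identity leaves `∫ (w')² = 0`. As
`w(1)` is free, the same identity carries the boundary value `c = flux(1)`. -/
lemma hasOp_of_weak (h : CoeffHyp a b K) {u : H1Zero a b} {f : L2w a b} {c : ℝ}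
    (hw : ∀ w : H1Zero a b,
      h.etaForm (dx u) (dx w) + inner ℝ f (toL2w w) = c * val w 1) : HasOp u f c := by
  refine ae_unit_of_forall_Ioo fun ε hε => ?_
  have hεI : ε ∈ Ioc (0 : ℝ) 1 := Ioo_subset_Ioc_self hε
  have hsub : Ioo ε 1 ⊆ Ioo 0 1 := Ioo_subset_Ioo_left hε.1.le
  set flux := fun x => c - ∫ s in x..1, f s / sigma a b s with hflux
  have hprim := h.isPrimitive_flux f c hεI
  change IsPrimitive flux _ ε 1 at hprim
  have hψ : MemLp ((Ioo ε 1).indicator fun x => h.etaMul (dx u) x - flux x) 2 unitMeasure := by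
    rw [memLp_indicator_iff_restrict measurableSet_Ioo]
    refine ((Lp.memLp _).restrict _).sub ?_
    obtain ⟨C, hC⟩ := isCompact_Icc.exists_bound_of_continuousOn (hprim.continuousOn hε.2.le)
    refine MemLp.of_bound (((hprim.continuousOn hε.2.le).mono
      Ioo_subset_Icc_self).aestronglyMeasurable measurableSet_Ioo) C ?_
    filter_upwards [ae_restrict_mem measurableSet_Ioo] with x hx
    exact hC x (Ioo_subset_Icc_self hx)
  set φ : L2unit := hψ.toLp _
  have hφae := hψ.coeFn_toLp
  have hφ0 : ∀ᵐ x ∂unitMeasure, x ≤ ε → φ x = 0 := by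
    filter_upwards [hφae] with x hx hxε
    rw [hx, indicator_of_notMem fun hc => not_lt.2 hxε hc.1]
  obtain ⟨w, hwφ⟩ := h.exists_dx_eq φ hε hφ0
  have hval0 : ∀ x ∈ Icc 0 ε, val w x = 0 := fun x hx =>
    val_eq_zero_of_ae hε (by rw [hwφ]; exact hφ0) hx
  have hI1 := h.integrable_weakForm u w f
  set k := fun s => f s * toL2w w s / sigma a b s + eta a b s * dx u s * dx w s
  have e1 : ∫ s in ε..1, k s = c * val w 1 := by
    have h0 : ∫ s in (0 : ℝ)..ε, k s = 0 := by
      refine intervalIntegral.integral_zero_ae ?_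
      have h1 := h.toL2w_ae w
      have h2 := hφ0
      rw [← hwφ] at h2
      rw [ae_restrict_iff' measurableSet_Ioo] at h1 h2
      filter_upwards [h1, h2] with s h1 h2 hs
      rw [uIoc_of_le hε.1.le] at hs
      have hs1 : s ∈ Ioo (0 : ℝ) 1 := ⟨hs.1, hs.2.trans_lt hε.2⟩
      simp only [k, h1 hs1, h2 hs1 hs.2, hval0 s (Ioc_subset_Icc_self hs)]
      ring
    have hadd := intervalIntegral.integral_add_adjacent_intervals
      (intervalIntegrable_unit hI1 (x := 0) (by simp) (Ioo_subset_Icc_self hε))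
      (intervalIntegrable_unit hI1 (y := 1) (Ioo_subset_Icc_self hε) (by simp))
    rw [h0, zero_add] at hadd
    rw [← hw w, h.etaForm_apply, h.inner_eq, add_comm,
      ← integral_add (h.integrable_inner f (toL2w w)) (h.integrable_etaForm _ _),
      integral_unit_eq, hadd]
  have hpw := isPrimitive_val w (Ioo_subset_Icc_self hε)
  have e2 := hprim.integral_mul hpw hε.2.le
  rw [hval0 ε ⟨hε.1.le, le_rfl⟩, mul_zero, sub_zero,
    show flux 1 = c by simp [flux]] at e2
  have e3 : ∫ s in ε..1, (k s - (f s / sigma a b s * val w s + flux s * dx w s)) = 0 := by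
    rw [intervalIntegral.integral_sub
      (intervalIntegrable_unit hI1 (Ioo_subset_Icc_self hε) (by simp))
      (hprim.intervalIntegrable_mul hpw hε.2.le), e1, e2, sub_self]
  have e4 : ∫ s in Ioo ε 1, φ s * φ s = 0 := by
    rw [← e3, intervalIntegral.integral_of_le hε.2.le, integral_Ioc_eq_integral_Ioo]
    refine integral_congr_ae ?_
    filter_upwards [ae_restrict_of_ae_restrict_of_subset hsub hφae,
      ae_restrict_of_ae_restrict_of_subset hsub (h.toL2w_ae w),
      ae_restrict_of_ae_restrict_of_subset hsub (h.etaMul_ae (dx u)),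
      ae_restrict_mem measurableSet_Ioo] with x h1 h2 h3 h4
    rw [indicator_of_mem h4, h3] at h1
    simp only [k, h2, hwφ, φ]
    rw [h1]
    ring
  have e5 := (setIntegral_eq_zero_iff_of_nonneg_ae
    (Eventually.of_forall fun s => mul_self_nonneg (φ s))
    (IntegrableOn.mono_set (s := Ioo ε 1) (integrable_mul_unit φ φ) hsub)).1 e4
  have e6 : ∀ᵐ x ∂volume.restrict (Ioo ε 1), eta a b x * dx u x = flux x := by
    filter_upwards [e5, ae_restrict_of_ae_restrict_of_subset hsub hφae,
      ae_restrict_of_ae_restrict_of_subset hsub (h.etaMul_ae (dx u)),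
      ae_restrict_mem measurableSet_Ioo] with x h1 h2 h3 h4
    rw [indicator_of_mem h4, h3] at h2
    have h5 : φ x = 0 := mul_self_eq_zero.1 h1
    exact sub_eq_zero.1 (h2.symm.trans h5)
  rwa [ae_restrict_iff' measurableSet_Ioo] at e6

lemma hasOp_iff (h : CoeffHyp a b K) {u : H1Zero a b} {f : L2w a b} {c : ℝ} :
    HasOp u f c ↔ ∀ w : H1Zero a b,
      h.etaForm (dx u) (dx w) + inner ℝ f (toL2w w) = c * val w 1 :=
  ⟨h.weak_of_hasOp, h.hasOp_of_weak⟩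

lemma eq_zero_of_toL2w (h : CoeffHyp a b K) {u : H1Zero a b} (hu : toL2w u = 0) : u = 0 := by
  refine h1Zero_ext hu ?_
  have hp := isPrimitive_val u (x := 0) (by simp)
  have h1 : EqOn (val u) (fun _ => 0) (Ioo 0 1) := by
    refine Measure.eqOn_open_of_ae_eq (μ := volume) ?_ isOpen_Ioo
      ((hp.continuousOn zero_le_one).mono Ioo_subset_Icc_self) continuousOn_const
    have h2 : ∀ᵐ x ∂unitMeasure, toL2w u x = 0 := by
      rw [hu]
      exact h.unitMeasure_absolutelyContinuous.ae_le (Lp.coeFn_zero _ _ _)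
    filter_upwards [h2, h.toL2w_ae u] with x hx1 hx2
    rw [← hx2, hx1]
  have h0 : val u 0 = 0 := intervalIntegral.integral_same
  have h3 := hp.ae_eq_zero_of_const zero_le_one fun x hx => by rw [h1 hx, h0]
  rw [← ae_restrict_iff' measurableSet_Ioo] at h3
  exact (Lp.eq_zero_iff_ae_eq_zero).2 h3

/-- If `u = 0` the flux vanishes almost everywhere, hence everywhere on `(0, 1]` by continuity, and
its derivative `f/σ` vanishes almost everywhere. -/
lemma eq_zero_of_hasOp (h : CoeffHyp a b K) {f : L2w a b} {c : ℝ}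
    (hf : HasOp (0 : H1Zero a b) f c) : f = 0 := by
  have h0 : ∀ᵐ x ∂unitMeasure, c - ∫ s in x..1, f s / sigma a b s = 0 := by
    have h1 : ∀ᵐ x ∂unitMeasure, dx (0 : H1Zero a b) x = 0 := Lp.coeFn_zero _ _ _
    filter_upwards [hf, h1] with x hx1 hx2
    rw [← hx1, hx2, mul_zero]
  have h2 : ∀ᵐ x ∂unitMeasure, f x / sigma a b x = 0 := by
    refine ae_unit_of_forall_Ioo fun ε hε => ?_
    have hprim := h.isPrimitive_flux f c (Ioo_subset_Ioc_self hε)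
    have hc := hprim.continuousOn hε.2.le
    have h3 : EqOn (fun x => c - ∫ s in x..1, f s / sigma a b s) (fun _ => 0) (Ioo ε 1) :=
      Measure.eqOn_open_of_ae_eq (μ := volume)
        (ae_restrict_of_ae_restrict_of_subset (Ioo_subset_Ioo_left hε.1.le) h0) isOpen_Ioo
        (hc.mono Ioo_subset_Icc_self) continuousOn_const
    have h4 : (fun x => c - ∫ s in x..1, f s / sigma a b s) ε = 0 := by
      have : EqOn (fun x => c - ∫ s in x..1, f s / sigma a b s) (fun _ => 0) (Icc ε 1) := by
        have hcl := h3.of_subset_closure hc continuousOn_const Ioo_subset_Icc_self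
          (by rw [closure_Ioo hε.2.ne])
        exact hcl
      exact this ⟨le_rfl, hε.2.le⟩
    exact hprim.ae_eq_zero_of_const hε.2.le fun x hx => (h3 hx).trans h4.symm
  refine (Lp.eq_zero_iff_ae_eq_zero).2
    ((withDensity_absolutelyContinuous unitMeasure _).ae_le ?_)
  filter_upwards [h2, ae_restrict_mem measurableSet_Ioo] with x hx hxI
  exact (div_eq_zero_iff.1 hx).resolve_right (h.sigma_pos (Ioo_subset_Ioc_self hxI)).ne'

end CoeffHyp

end

/-! ### The wave operator: energy identity, resolvent equation and density of the domain. -/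

section

variable {a b : ℝ → ℝ} {K β : ℝ}

/-- Scalar product of a real inner product space, as a continuous bilinear form. -/
noncomputable def innerForm (F : Type*) [NormedAddCommGroup F] [InnerProductSpace ℝ F] :
    F →L[ℝ] F →L[ℝ] ℝ := innerSL ℝ

@[simp] lemma innerForm_apply {F : Type*} [NormedAddCommGroup F] [InnerProductSpace ℝ F]
    (x y : F) : innerForm F x y = inner ℝ x y := rfl

namespace CoeffHyp

/-- The form `κ ∫ u w / σ + ∫ η u' w' + γ u(1) w(1)` on `H¹_{1/σ,0}`. -/
noncomputable def h1Form (h : CoeffHyp a b K) (κ γ : ℝ) :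
    H1Zero a b →L[ℝ] H1Zero a b →L[ℝ] ℝ :=
  κ • (innerForm (L2w a b)).bilinearComp (toL2wL a b) (toL2wL a b) +
    h.etaForm.bilinearComp (dxL a b) (dxL a b) +
    γ • (ContinuousLinearMap.mul ℝ ℝ).bilinearComp (traceL a b) (traceL a b)

lemma h1Form_apply (h : CoeffHyp a b K) (κ γ : ℝ) (u w : H1Zero a b) :
    h.h1Form κ γ u w = κ * inner ℝ (toL2w u) (toL2w w) + h.etaForm (dx u) (dx w) +
      γ * (val u 1 * val w 1) := by
  simp [h1Form]

lemma exists_h1Form_coercive (h : CoeffHyp a b K) {κ γ : ℝ} (hκ : 0 < κ) (hγ : 0 ≤ γ) :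
    ∃ m : ℝ, 0 < m ∧ ∀ u : H1Zero a b, m * ‖u‖ ^ 2 ≤ h.h1Form κ γ u u := by
  obtain ⟨m, M, hm, -, hmM⟩ := h.exists_eta_bounds
  refine ⟨min κ m, lt_min hκ hm, fun u => ?_⟩
  rw [h1Form_apply, real_inner_self_eq_norm_sq, norm_sq_eq, mul_add]
  have h1 := (h.etaForm_bounds hmM (dx u)).1
  have h2 : min κ m * ‖toL2w u‖ ^ 2 ≤ κ * ‖toL2w u‖ ^ 2 := by gcongr; exact min_le_left _ _
  have h3 : min κ m * ‖dx u‖ ^ 2 ≤ m * ‖dx u‖ ^ 2 := by gcongr; exact min_le_right _ _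
  have h4 : 0 ≤ γ * (val u 1 * val u 1) := mul_nonneg hγ (mul_self_nonneg _)
  linarith

/-- Lax–Milgram for the form `h1Form`. -/
lemma exists_h1Form_eq (h : CoeffHyp a b K) {κ γ : ℝ} (hκ : 0 < κ) (hγ : 0 ≤ γ)
    (ℓ : H1Zero a b →L[ℝ] ℝ) : ∃ u, ∀ w, h.h1Form κ γ u w = ℓ w := by
  obtain ⟨m, hm, hc⟩ := h.exists_h1Form_coercive hκ hγ
  have hco : IsCoercive (h.h1Form κ γ) := ⟨m, hm, fun u => by
    rw [mul_assoc, ← sq]; exact hc u⟩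
  refine ⟨hco.continuousLinearEquivOfBilin.symm
    ((InnerProductSpace.toDual ℝ (H1Zero a b)).symm ℓ), fun w => ?_⟩
  rw [← hco.continuousLinearEquivOfBilin_apply, ContinuousLinearEquiv.apply_symm_apply,
    InnerProductSpace.toDual_symm_apply]

/-- The form `h1Form` on the first component plus the scalar product of `L²_{1/σ}` on the
second one. -/
noncomputable def stateForm (h : CoeffHyp a b K) (κ γ : ℝ) :
    (H1Zero a b × L2w a b) →L[ℝ] (H1Zero a b × L2w a b) →L[ℝ] ℝ :=
  (h.h1Form κ γ).bilinearComp (ContinuousLinearMap.fst ℝ _ _) (ContinuousLinearMap.fst ℝ _ _) +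
    (innerForm (L2w a b)).bilinearComp (ContinuousLinearMap.snd ℝ _ _)
      (ContinuousLinearMap.snd ℝ _ _)

lemma stateForm_apply (h : CoeffHyp a b K) (κ γ : ℝ) (X Y : H1Zero a b × L2w a b) :
    h.stateForm κ γ X Y = κ * inner ℝ (toL2w X.1) (toL2w Y.1) + h.etaForm (dx X.1) (dx Y.1) +
      γ * (val X.1 1 * val Y.1 1) + inner ℝ X.2 Y.2 := by
  rw [← h1Form_apply]
  simp [stateForm]

lemma stateForm_symm (h : CoeffHyp a b K) (κ γ : ℝ) (X Y : H1Zero a b × L2w a b) :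
    h.stateForm κ γ X Y = h.stateForm κ γ Y X := by
  rw [stateForm_apply, stateForm_apply, real_inner_comm, h.etaForm_symm, real_inner_comm Y.2]
  ring

/-- The boundary condition determines `c`, which turns the existential into a family of linear
equations, continuous in `(X, W)`. Linearity and closedness of the graph are read off from it. -/
lemma isWaveOp_iff (h : CoeffHyp a b K) {X W : H1Zero a b × L2w a b} :
    IsWaveOp β X W ↔ toL2w W.1 = X.2 ∧ ∀ w : H1Zero a b,
      h.etaForm (dx X.1) (dx w) + inner ℝ W.2 (toL2w w) +
        (val W.1 1 + β * val X.1 1) * val w 1 = 0 := by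
  refine and_congr_right fun _ => ⟨?_, fun h1 => ?_⟩
  · rintro ⟨c, hc, hbc⟩ w
    have h2 := h.hasOp_iff.1 hc w
    rw [h2]
    linear_combination val w 1 * hbc
  · refine ⟨-(val W.1 1 + β * val X.1 1), h.hasOp_iff.2 fun w => ?_, by ring⟩
    linear_combination h1 w

/-- The graph of the wave operator. -/
noncomputable def waveGraph (h : CoeffHyp a b K) (β : ℝ) :
    Submodule ℝ ((H1Zero a b × L2w a b) × (H1Zero a b × L2w a b)) where
  carrier := {p | IsWaveOp β p.1 p.2}
  zero_mem' := by
    refine h.isWaveOp_iff.2 ⟨(toL2wL a b).map_zero, fun w => ?_⟩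
    simp [← dxL_apply, ← traceL_apply]
  add_mem' := by
    intro p q hp hq
    obtain ⟨hp1, hp2⟩ := h.isWaveOp_iff.1 hp
    obtain ⟨hq1, hq2⟩ := h.isWaveOp_iff.1 hq
    refine h.isWaveOp_iff.2 ⟨?_, fun w => ?_⟩
    · rw [Prod.snd_add, Prod.fst_add, ← toL2wL_apply, map_add, Prod.fst_add, Prod.snd_add, ← hp1,
        ← hq1]
      rfl
    · have h1 := hp2 w
      have h2 := hq2 w
      simp only [Prod.fst_add, Prod.snd_add, ← dxL_apply, ← traceL_apply, map_add, add_apply,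
        inner_add_left] at h1 h2 ⊢
      linear_combination h1 + h2
  smul_mem' := by
    intro c p hp
    obtain ⟨hp1, hp2⟩ := h.isWaveOp_iff.1 hp
    refine h.isWaveOp_iff.2 ⟨?_, fun w => ?_⟩
    · rw [Prod.smul_snd, Prod.smul_fst, ← toL2wL_apply, map_smul, Prod.smul_fst, Prod.smul_snd,
        ← hp1]
      rfl
    · have h1 := hp2 w
      simp only [Prod.smul_fst, Prod.smul_snd, ← dxL_apply, ← traceL_apply, map_smul, smul_apply,
        inner_smul_left, smul_eq_mul, conj_trivial] at h1 ⊢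
      linear_combination c * h1

lemma mem_waveGraph (h : CoeffHyp a b K) {p : (H1Zero a b × L2w a b) × (H1Zero a b × L2w a b)} :
    p ∈ h.waveGraph β ↔ IsWaveOp β p.1 p.2 := Iff.rfl

lemma isClosed_waveGraph (h : CoeffHyp a b K) :
    IsClosed (h.waveGraph β : Set ((H1Zero a b × L2w a b) × (H1Zero a b × L2w a b))) := by
  have e : (h.waveGraph β : Set ((H1Zero a b × L2w a b) × (H1Zero a b × L2w a b))) =
      {p | toL2wL a b p.2.1 = p.1.2} ∩ ⋂ w : H1Zero a b,
        {p | h.etaForm (dxL a b p.1.1) (dxL a b w) + inner ℝ p.2.2 (toL2wL a b w) +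
          (traceL a b p.2.1 + β * traceL a b p.1.1) * traceL a b w = 0} := by
    ext p
    simp only [SetLike.mem_coe, mem_waveGraph, h.isWaveOp_iff, mem_inter_iff, mem_ofPred_eq,
      mem_iInter, toL2wL_apply, dxL_apply, traceL_apply]
  rw [e]
  refine (isClosed_eq (by fun_prop) (by fun_prop)).inter (isClosed_iInter fun w => ?_)
  exact isClosed_eq (by fun_prop) continuous_const

/-- The weak identity is tested with the velocity `W.1` itself. The choice `γ = β` cancels the term
`β u(1) v(1)`, and the boundary damping leaves `-v(1)²`. -/
lemma stateForm_waveOp (h : CoeffHyp a b K) (κ : ℝ) {X W : H1Zero a b × L2w a b}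
    (hX : IsWaveOp β X W) :
    h.stateForm κ β W X = κ * inner ℝ X.2 (toL2w X.1) - val W.1 1 ^ 2 := by
  obtain ⟨h1, h2⟩ := h.isWaveOp_iff.1 hX
  have h3 := h2 W.1
  rw [h1] at h3
  rw [stateForm_apply, h1, h.etaForm_symm]
  linear_combination h3

lemma stateForm_one_dissipative (h : CoeffHyp a b K) (hβ : 0 ≤ β)
    {X W : H1Zero a b × L2w a b} (hX : IsWaveOp β X W) :
    h.stateForm 1 β W X ≤ 1 / 2 * h.stateForm 1 β X X := by
  obtain ⟨m, M, hm, -, hmM⟩ := h.exists_eta_bounds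
  rw [h.stateForm_waveOp 1 hX, stateForm_apply, real_inner_self_eq_norm_sq,
    real_inner_self_eq_norm_sq]
  have h1 := real_inner_le_norm X.2 (toL2w X.1)
  have h2 := (h.etaForm_bounds hmM (dx X.1)).1
  have h3 : 0 ≤ β * (val X.1 1 * val X.1 1) := mul_nonneg hβ (mul_self_nonneg _)
  have h4 : 0 ≤ m * ‖dx X.1‖ ^ 2 := by positivity
  nlinarith [sq_nonneg (‖X.2‖ - ‖toL2w X.1‖), sq_nonneg (val W.1 1)]

lemma stateForm_zero_dissipative (h : CoeffHyp a b K) {X W : H1Zero a b × L2w a b}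
    (hX : IsWaveOp β X W) : h.stateForm 0 β W X ≤ 0 := by
  rw [h.stateForm_waveOp 0 hX]
  nlinarith [sq_nonneg (val W.1 1)]

lemma exists_stateForm_coercive (h : CoeffHyp a b K) (hβ : 0 ≤ β) :
    ∃ m : ℝ, 0 < m ∧ ∀ X : H1Zero a b × L2w a b, m * ‖X‖ ^ 2 ≤ h.stateForm 1 β X X := by
  obtain ⟨m, hm, hc⟩ := h.exists_h1Form_coercive one_pos hβ
  refine ⟨min m 1, lt_min hm one_pos, fun X => ?_⟩
  rw [stateForm_apply, ← h1Form_apply, real_inner_self_eq_norm_sq]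
  have h1 := hc X.1
  have h2 : ‖X‖ ^ 2 ≤ ‖X.1‖ ^ 2 + ‖X.2‖ ^ 2 := by
    rw [Prod.norm_def]
    rcases max_choice ‖X.1‖ ‖X.2‖ with h | h <;> rw [h] <;>
      nlinarith [sq_nonneg ‖X.1‖, sq_nonneg ‖X.2‖]
  have h3 : min m 1 * ‖X.1‖ ^ 2 ≤ m * ‖X.1‖ ^ 2 := by gcongr; exact min_le_left _ _
  have h4 : min m 1 * ‖X.2‖ ^ 2 ≤ 1 * ‖X.2‖ ^ 2 := by gcongr; exact min_le_right _ _
  have h5 := mul_le_mul_of_nonneg_left h2 (lt_min hm one_pos).le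
  linarith

/-- Eliminating `v = μ u - f` from `μ v - A u = g` leaves `μ² u - A u = g + μ f`. The boundary
condition becomes the Robin term `(μ + β) u(1) w(1)`, with `f(1) w(1)` on the right, and Lax–Milgram
applies. -/
lemma exists_resolvent_eq (h : CoeffHyp a b K) (hβ : 0 ≤ β) {μ : ℝ} (hμ : 0 < μ)
    (z : H1Zero a b × L2w a b) : ∃ p ∈ h.waveGraph β, μ • p.1 - p.2 = z := by
  obtain ⟨f, g⟩ := z
  obtain ⟨u, hu⟩ := h.exists_h1Form_eq (κ := μ ^ 2) (γ := μ + β) (by positivity) (by positivity)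
    ((innerForm (L2w a b) (g + μ • toL2w f)).comp (toL2wL a b) + val f 1 • traceL a b)
  set v := μ • u - f
  have hv1 : toL2w v = μ • toL2w u - toL2w f := by
    simp only [← toL2wL_apply, v, map_sub, map_smul]
  have hv2 : val v 1 = μ * val u 1 - val f 1 := by
    simp only [← traceL_apply, v, map_sub, map_smul, smul_eq_mul]
  refine ⟨((u, toL2w v), (v, μ • toL2w v - g)), h.isWaveOp_iff.2 ⟨rfl, fun w => ?_⟩, ?_⟩
  · have h1 := hu w
    rw [h1Form_apply] at h1
    simp only [add_apply, ContinuousLinearMap.comp_apply, smul_apply, toL2wL_apply, traceL_apply,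
      innerForm_apply, smul_eq_mul, inner_add_left, inner_smul_left, conj_trivial] at h1
    simp only [hv1, hv2, inner_sub_left, inner_smul_left, conj_trivial]
    linear_combination h1
  · ext1
    · simp [v]
    · simp

lemma eq_zero_of_isWaveOp (h : CoeffHyp a b K) {W : H1Zero a b × L2w a b}
    (hW : IsWaveOp β 0 W) : W = 0 := by
  obtain ⟨h1, c, h2, -⟩ := hW
  exact Prod.ext (h.eq_zero_of_toL2w h1) (h.eq_zero_of_hasOp h2)

/-- The product carries the maximum norm and is not a Hilbert space as it stands, so the functional
is represented one component at a time. -/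
lemma exists_stateForm_eq (h : CoeffHyp a b K) (hβ : 0 ≤ β)
    (ℓ : (H1Zero a b × L2w a b) →L[ℝ] ℝ) : ∃ z, ∀ X, h.stateForm 1 β z X = ℓ X := by
  obtain ⟨u, hu⟩ := h.exists_h1Form_eq one_pos hβ
    (ℓ.comp (ContinuousLinearMap.inl ℝ (H1Zero a b) (L2w a b)))
  refine ⟨(u, (InnerProductSpace.toDual ℝ _).symm
    (ℓ.comp (ContinuousLinearMap.inr ℝ (H1Zero a b) (L2w a b)))), fun X => ?_⟩
  rw [stateForm_apply, ← h1Form_apply, hu, InnerProductSpace.toDual_symm_apply]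
  simp only [ContinuousLinearMap.comp_apply, ContinuousLinearMap.inl_apply,
    ContinuousLinearMap.inr_apply]
  rw [← map_add]
  simp

/-- Otherwise Hahn–Banach gives a nonzero functional `B(z, ·)` that vanishes on the domain. Solving
`p.1 - 𝒜 p.1 = z` gives `B(p.1, p.1) = B(𝒜 p.1, p.1) ≤ ½ B(p.1, p.1)`, so `p.1 = 0` and then `z =
0`. -/
lemma dense_waveGraph (h : CoeffHyp a b K) (hβ : 0 ≤ β) :
    Dense (Prod.fst ''
      (h.waveGraph β : Set ((H1Zero a b × L2w a b) × (H1Zero a b × L2w a b)))) := by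
  set D := (h.waveGraph β).map (LinearMap.fst ℝ _ _) with hD
  change Dense (D : Set (H1Zero a b × L2w a b))
  rw [Submodule.dense_iff_topologicalClosure_eq_top, Submodule.eq_top_iff']
  intro x
  by_contra hx
  obtain ⟨ℓ, r, h1, h2⟩ := geometric_hahn_banach_closed_point
    (s := (D.topologicalClosure : Set (H1Zero a b × L2w a b)))
    D.topologicalClosure.convex D.isClosed_topologicalClosure hx
  have hr : 0 < r := by simpa using h1 0 (zero_mem _)
  have hℓ : ∀ y ∈ D, ℓ y = 0 := by
    intro y hy
    by_contra hc
    have h3 := h1 ((r / ℓ y) • y) (D.le_topologicalClosure (D.smul_mem _ hy))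
    rw [map_smul, smul_eq_mul, div_mul_cancel₀ _ hc] at h3
    exact h3.false
  obtain ⟨z, hz⟩ := h.exists_stateForm_eq hβ ℓ
  obtain ⟨p, hp, hpz⟩ := h.exists_resolvent_eq hβ one_pos z
  have h3 : ℓ p.1 = 0 := hℓ _ ⟨p, hp, rfl⟩
  rw [← hz, ← hpz, one_smul, map_sub, sub_apply] at h3
  have h4 := h.stateForm_one_dissipative hβ hp
  obtain ⟨m, hm, hc⟩ := h.exists_stateForm_coercive hβ
  have h5 : ‖p.1‖ ^ 2 ≤ 0 := by
    by_contra hcon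
    push Not at hcon
    nlinarith [hc p.1, mul_pos hm hcon]
  have h6 : p.1 = 0 := norm_eq_zero.1 (pow_eq_zero_iff two_ne_zero |>.1
    (le_antisymm h5 (sq_nonneg _)))
  have h7 : p.2 = 0 := h.eq_zero_of_isWaveOp (β := β) (by rw [← h6]; exact hp)
  have h8 : z = 0 := by rw [← hpz, h6, h7]; simp
  have h9 := hz x
  rw [h8, map_zero, zero_apply] at h9
  linarith

theorem isGenerator_waveGraph (h : CoeffHyp a b K) (hβ : 0 ≤ β) :
    IsGenerator (h.waveGraph β) (h.stateForm 1 β) (1 / 2) where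
  isClosed := h.isClosed_waveGraph
  symm := h.stateForm_symm 1 β
  coercive := h.exists_stateForm_coercive hβ
  nonneg := by norm_num
  dissipative _ hp := h.stateForm_one_dissipative hβ hp
  range μ hμ z := h.exists_resolvent_eq hβ (by linarith) z
  dense := h.dense_waveGraph hβ

end CoeffHyp

end

/-! ### Hardy's inequality and the weighted Poincaré inequality for `K ≤ 2`. -/

section

variable {a b : ℝ → ℝ} {K β : ℝ}

/-- Hardy's inequality on `[ε, 1]`. -/
lemma hardy_bound (φ : L2unit) {k : ℝ → ℝ} {C ε : ℝ} (hC : 0 < C) (hε : ε ∈ Ioo (0 : ℝ) 1)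
    (hk : IntervalIntegrable k volume ε 1)
    (hle : ∀ᵐ x ∂volume.restrict (Ioo ε 1), k x ≤ C * ((∫ s in (0 : ℝ)..x, φ s) * x⁻¹) ^ 2) :
    ∫ x in ε..1, k x ≤ 6 * C * ‖φ‖ ^ 2 := by
  have hεI := Ioo_subset_Icc_self hε
  set U := fun x => ∫ s in (0 : ℝ)..x, φ s
  have hU : IsPrimitive U φ ε 1 := isPrimitive_primitive (integrable_L2unit φ) hεI
  have hinv : IsPrimitive (fun x : ℝ => x⁻¹) (fun x => -(x ^ 2)⁻¹) ε 1 := by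
    have hc : ContinuousOn (fun x : ℝ => -(x ^ 2)⁻¹) (Icc ε 1) :=
      ((continuousOn_pow 2).inv₀ fun x hx => (pow_pos (hε.1.trans_le hx.1) 2).ne').neg
    refine ⟨(by rw [uIcc_of_le hε.2.le]; exact hc : ContinuousOn _ _).intervalIntegrable,
      fun y hy => ?_⟩
    rw [intervalIntegral.integral_eq_sub_of_hasDerivAt (f := fun x : ℝ => x⁻¹)]
    · ring
    · intro x hx
      rw [uIcc_of_le hy.1] at hx
      exact hasDerivAt_inv (hε.1.trans_le hx.1).ne'
    · refine ContinuousOn.intervalIntegrable ?_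
      rw [uIcc_of_le hy.1]
      exact hc.mono (Icc_subset_Icc_right hy.2)
  have hV := hU.mul hinv hε.2.le
  have h1 := hU.integral_mul hV hε.2.le
  have h2 := hU.intervalIntegrable_mul hV hε.2.le
  have h3 : U ε ^ 2 ≤ ε * ‖φ‖ ^ 2 := primitive_sq_le φ hεI
  have hφ := intervalIntegrable_unit (integrable_mul_unit φ φ) hεI (y := 1) (by simp)
  have h4 : ∫ x in ε..1, φ x * φ x ≤ ‖φ‖ ^ 2 := by
    rw [← real_inner_self_eq_norm_sq, inner_unit, intervalIntegral.integral_of_le hε.2.le,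
      integral_Ioc_eq_integral_Ioo]
    exact setIntegral_mono_set (integrable_mul_unit φ φ)
      (Eventually.of_forall fun x => mul_self_nonneg (φ x))
      (Ioo_subset_Ioo_left hε.1.le).eventuallyLE
  -- Completing the square: `(U/x)² = 4 φ² - 2 (U²/x)' - (2 φ - U/x)²`. After integration the
  -- boundary term at `ε` is at most `2 C ‖φ‖²`, the one at `1` has the good sign, and the total
  -- constant is `4 + 2 = 6`, independent of `ε`.
  have h5 : ∫ x in ε..1, k x ≤ ∫ x in ε..1, (4 * C * (φ x * φ x) -
      2 * C * (φ x * (U x * x⁻¹) + U x * (φ x * x⁻¹ + U x * -(x ^ 2)⁻¹))) := by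
    rw [intervalIntegral.integral_of_le hε.2.le, intervalIntegral.integral_of_le hε.2.le,
      integral_Ioc_eq_integral_Ioo, integral_Ioc_eq_integral_Ioo]
    have hi := (hφ.const_mul (4 * C)).sub (h2.const_mul (2 * C))
    rw [intervalIntegrable_iff_integrableOn_Ioo_of_le hε.2.le] at hi hk
    refine integral_mono_ae hk hi ?_
    filter_upwards [hle, ae_restrict_mem measurableSet_Ioo] with x hx hxI
    refine hx.trans ?_
    rw [← sub_nonneg]
    have : 4 * C * (φ x * φ x) -
        2 * C * (φ x * (U x * x⁻¹) + U x * (φ x * x⁻¹ + U x * -(x ^ 2)⁻¹)) -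
        C * (U x * x⁻¹) ^ 2 = C * (2 * φ x - U x * x⁻¹) ^ 2 := by
      rw [inv_pow x 2 |>.symm]; ring
    rw [this]
    positivity
  rw [intervalIntegral.integral_sub (hφ.const_mul _) (h2.const_mul _),
    intervalIntegral.integral_const_mul, intervalIntegral.integral_const_mul, h1] at h5
  have h6 : U ε * (U ε * ε⁻¹) ≤ ‖φ‖ ^ 2 := by
    rw [← mul_assoc, ← sq, mul_inv_le_iff₀ hε.1]
    linarith
  have h7 : 0 ≤ U 1 * (U 1 * 1⁻¹) := by rw [inv_one, mul_one]; exact mul_self_nonneg _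
  have h8 : 0 ≤ C * (‖φ‖ ^ 2 - ∫ x in ε..1, φ x * φ x) := mul_nonneg hC.le (by linarith)
  have h9 : 0 ≤ C * (‖φ‖ ^ 2 - U ε * (U ε * ε⁻¹) + U 1 * (U 1 * 1⁻¹)) :=
    mul_nonneg hC.le (by linarith)
  nlinarith

namespace CoeffHyp

/-- Near `0`, `x² / a ≤ x^K / a`, and monotonicity bounds the latter by its value at a fixed `d`; on
`[d, 1]` the function `1/σ` is bounded. -/
lemma exists_one_div_sigma_le (h : CoeffHyp a b K) (hK : K ≤ 2) :
    ∃ C : ℝ, 0 < C ∧ ∀ x ∈ Ioo (0 : ℝ) 1, 1 / sigma a b x ≤ C * x⁻¹ ^ 2 := by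
  obtain ⟨m, M, _, hM, hmM⟩ := h.exists_eta_bounds
  obtain ⟨δ, hδ, hmono⟩ := h.monotone_near_zero
  -- Monotonicity is known only on the open interval `(0, δ)`, so the comparison point must lie
  -- inside it.
  set d := δ / 2 with hd
  have hdI : d ∈ Ioc (0 : ℝ) 1 := ⟨by linarith [hδ.1], by linarith [hδ.2, hδ.1]⟩
  obtain ⟨C', hC'⟩ := (isCompact_Icc (a := d) (b := 1)).exists_bound_of_continuousOn
    (h.continuousOn_one_div_sigma.mono fun y hy => ⟨hdI.1.trans_le hy.1, hy.2⟩)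
  have hc : 0 < d ^ K / a d := div_pos (Real.rpow_pos_of_pos hdI.1 _) (h.a_pos d hdI)
  refine ⟨max (M * (d ^ K / a d)) C', lt_max_of_lt_left (mul_pos hM hc), fun x hx => ?_⟩
  have hinv : 1 ≤ x⁻¹ := (one_le_inv₀ hx.1).2 hx.2.le
  rcases le_total x d with hxd | hxd
  · have h1 := hmono (a := x) (b := d) ⟨hx.1, by linarith [hδ.1]⟩
      ⟨hdI.1, by linarith [hδ.1]⟩ hxd
    dsimp only at h1
    have hax := h.a_pos x (Ioo_subset_Ioc_self hx)
    have hx2 : x ^ 2 ≤ x ^ K := by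
      rw [← Real.rpow_natCast]
      exact Real.rpow_le_rpow_of_exponent_ge hx.1 hx.2.le (by simpa using hK)
    have h2 : 1 / sigma a b x ≤ M * (d ^ K / a d) * x⁻¹ ^ 2 := by
      rw [sigma, one_div_div, inv_pow, ← div_eq_mul_inv, le_div_iff₀ (pow_pos hx.1 2)]
      calc eta a b x / a x * x ^ 2 = eta a b x * (x ^ 2 / a x) := by ring
        _ ≤ M * (x ^ K / a x) := by
            gcongr
            exact (hmM x (Ioo_subset_Icc_self hx)).2
        _ ≤ M * (d ^ K / a d) := by gcongr
    exact h2.trans (by gcongr; exact le_max_left _ _)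
  · have h1 := (Real.le_norm_self _).trans (hC' x ⟨hxd, hx.2.le⟩)
    calc 1 / sigma a b x ≤ C' := h1
      _ ≤ max (M * (d ^ K / a d)) C' := le_max_right _ _
      _ ≤ max (M * (d ^ K / a d)) C' * x⁻¹ ^ 2 :=
        le_mul_of_one_le_right (le_max_of_le_left (mul_pos hM hc).le) (one_le_pow₀ hinv)

/-- Poincaré's inequality in the weighted space, for `K ≤ 2`. -/
lemma exists_poincare (h : CoeffHyp a b K) (hK : K ≤ 2) :
    ∃ C : ℝ, 0 < C ∧ ∀ u : H1Zero a b, ‖toL2w u‖ ^ 2 ≤ C * ‖dx u‖ ^ 2 := by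
  obtain ⟨C, hC, hσ⟩ := h.exists_one_div_sigma_le hK
  refine ⟨6 * C, by positivity, fun u => ?_⟩
  have hki := h.integrable_inner (toL2w u) (toL2w u)
  set k := fun x => toL2w u x * toL2w u x / sigma a b x
  rw [← real_inner_self_eq_norm_sq, h.inner_eq, integral_unit_eq]
  have hlim : Tendsto (fun x => ∫ s in x..1, k s) (𝓝[>] 0) (𝓝 (∫ s in (0 : ℝ)..1, k s)) := by
    have h2 := intervalIntegral.continuousOn_primitive_interval' (a := 1)
      (intervalIntegrable_unit hki (x := 0) (y := 1) (by simp) (by simp)) (by simp)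
    rw [uIcc_of_le zero_le_one] at h2
    have h1 : ContinuousOn (fun x => ∫ s in x..1, k s) (Icc 0 1) :=
      h2.neg.congr fun x _ => intervalIntegral.integral_symm _ _
    have h3 := (h1 0 (by simp)).mono_left
      (nhdsWithin_mono 0 (Ioc_subset_Icc_self (a := (0 : ℝ)) (b := 1)))
    rwa [nhdsWithin_Ioc_eq_nhdsGT zero_lt_one] at h3
  refine le_of_tendsto hlim ?_
  filter_upwards [Ioo_mem_nhdsGT (zero_lt_one' ℝ)] with ε hε
  refine hardy_bound (dx u) hC hε
    (intervalIntegrable_unit hki (Ioo_subset_Icc_self hε) (by simp)) ?_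
  have hsub : Ioo ε 1 ⊆ Ioo 0 1 := Ioo_subset_Ioo_left hε.1.le
  filter_upwards [ae_restrict_of_ae_restrict_of_subset hsub (h.toL2w_ae u),
    ae_restrict_mem measurableSet_Ioo] with x h1 h2
  simp only [k]
  rw [h1, mul_pow]
  change val u x * val u x / sigma a b x ≤ C * (val u x ^ 2 * x⁻¹ ^ 2)
  have h3 := mul_le_mul_of_nonneg_left (hσ x (hsub h2)) (sq_nonneg (val u x))
  calc _ = val u x ^ 2 * (1 / sigma a b x) := by ring
    _ ≤ _ := h3
    _ = _ := by ring

end CoeffHyp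

end

/-! ### Well-posedness, stability estimates and classical solutions. -/

section

variable {a b : ℝ → ℝ} {K β : ℝ}

lemma contDiffOn_one_Ici {F : Type*} [NormedAddCommGroup F] [NormedSpace ℝ F] {f f' : ℝ → F}
    (hf : ∀ t, 0 ≤ t → HasDerivWithinAt f (f' t) (Ici 0) t) (hf' : ContinuousOn f' (Ici 0)) :
    ContDiffOn ℝ 1 f (Ici 0) := by
  have h1 := contDiffOn_succ_iff_derivWithin (𝕜 := ℝ) (f := f) (n := 0)
    (uniqueDiffOn_Ici (0 : ℝ))
  rw [zero_add] at h1
  refine h1.2 ⟨fun t ht => (hf t ht).differentiableWithinAt, by simp, ?_⟩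
  rw [contDiffOn_zero]
  exact hf'.congr fun t ht => (hf t ht).derivWithin (uniqueDiffOn_Ici 0 t ht)

lemma exists_apply_self_le {E : Type*} [NormedAddCommGroup E] [NormedSpace ℝ E]
    (B : E →L[ℝ] E →L[ℝ] ℝ) : ∃ M : ℝ, 0 ≤ M ∧ ∀ x, B x x ≤ M * ‖x‖ ^ 2 :=
  ⟨‖B‖, B.opNorm_nonneg, fun x => by
    rw [sq, ← mul_assoc]
    exact (le_abs_self _).trans (B.le_opNorm₂ x x)⟩

namespace CoeffHyp

lemma isMild_state (h : CoeffHyp a b K) {Y₀ : H1Zero a b × L2w a b} {y : ℝ → H1Zero a b}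
    (hy : IsMildSolution β Y₀ y) : IsMild (h.waveGraph β) Y₀ (state y) :=
  ⟨hy.continuousOn_state, hy.integrated⟩

/-- The first row of the integrated equation says that, in `L²_{1/σ}`, the first component is a
primitive of the continuous second one. So the second component of an abstract mild solution is the
velocity of the first, and the two notions of mild solution agree. -/
lemma hasDerivWithinAt_toL2w (h : CoeffHyp a b K) {Y₀ : H1Zero a b × L2w a b}
    {X : ℝ → H1Zero a b × L2w a b} (hX : IsMild (h.waveGraph β) Y₀ X) {t : ℝ} (ht : 0 ≤ t) :
    HasDerivWithinAt (fun s => toL2w (X s).1) (X t).2 (Ici 0) t := by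
  have h1 : ∀ s ∈ Ici (0 : ℝ), toL2w (X s).1 = toL2w Y₀.1 + ∫ r in (0 : ℝ)..s, (X r).2 := by
    intro s hs
    have h2 := (h.isWaveOp_iff.1 (hX.mem s hs)).1
    have h3 := (ContinuousLinearMap.snd ℝ (H1Zero a b) (L2w a b)).intervalIntegral_comp_comm
      (hX.intervalIntegrable hs)
    simp only [ContinuousLinearMap.coe_snd'] at h3
    rw [h3, ← h2, Prod.fst_sub, ← toL2wL_apply, ← toL2wL_apply, ← toL2wL_apply, map_sub]
    abel
  exact ((hasDerivWithinAt_integral_Ici hX.continuousOn.snd ht).const_add _).congr h1 (h1 t ht)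

lemma state_eqOn (h : CoeffHyp a b K) {Y₀ : H1Zero a b × L2w a b}
    {X : ℝ → H1Zero a b × L2w a b} (hX : IsMild (h.waveGraph β) Y₀ X) :
    EqOn (state fun t => (X t).1) X (Ici 0) := fun t ht =>
  Prod.ext rfl ((h.hasDerivWithinAt_toL2w hX ht).derivWithin (uniqueDiffOn_Ici 0 t ht))

lemma isMildSolution_of_isMild (h : CoeffHyp a b K) {Y₀ : H1Zero a b × L2w a b}
    {X : ℝ → H1Zero a b × L2w a b} (hX : IsMild (h.waveGraph β) Y₀ X) :
    IsMildSolution β Y₀ fun t => (X t).1 :=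
  have h1 := hX.congr (h.state_eqOn hX)
  ⟨h1.continuousOn, h1.mem⟩

theorem exists_isMildSolution (h : CoeffHyp a b K) (hβ : 0 ≤ β) (Y₀ : H1Zero a b × L2w a b) :
    ∃ y : ℝ → H1Zero a b, IsMildSolution β Y₀ y ∧
      ContDiffOn ℝ 1 (fun t => toL2w (y t)) (Ici 0) ∧ ContinuousOn y (Ici 0) ∧
      y 0 = Y₀.1 ∧ velocity y 0 = Y₀.2 ∧
      ∀ z : ℝ → H1Zero a b, IsMildSolution β Y₀ z → EqOn z y (Ici 0) := by
  have hG := h.isGenerator_waveGraph hβ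
  obtain ⟨X, hX⟩ := hG.exists_isMild Y₀
  have hy := h.isMildSolution_of_isMild hX
  have h0 := hG.mild_zero (h.isMild_state hy)
  refine ⟨fun t => (X t).1, hy, ?_, hX.continuousOn.fst, congrArg Prod.fst (hG.mild_zero hX),
    congrArg Prod.snd h0, fun z hz t ht => ?_⟩
  · exact contDiffOn_one_Ici (fun t ht => h.hasDerivWithinAt_toL2w hX ht)
      hX.continuousOn.snd
  · exact congrArg Prod.fst (hG.mild_unique (h.isMild_state hz) hX ht)

lemma energyNorm_sq (hβ : 0 ≤ β) (X : H1Zero a b × L2w a b) :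
    energyNorm β X ^ 2 = ‖dx X.1‖ ^ 2 + ‖X.2‖ ^ 2 + β * val X.1 1 ^ 2 :=
  Real.sq_sqrt (by positivity)

lemma exists_energyNorm_bounds (h : CoeffHyp a b K) (hβ : 0 ≤ β) :
    ∃ m M : ℝ, 0 < m ∧ 0 < M ∧ ∀ X : H1Zero a b × L2w a b,
      m * energyNorm β X ^ 2 ≤ h.stateForm 0 β X X ∧
      h.stateForm 0 β X X ≤ M * energyNorm β X ^ 2 := by
  obtain ⟨m, M, hm, hM, hmM⟩ := h.exists_eta_bounds
  refine ⟨min m 1, max M 1, lt_min hm one_pos, lt_max_of_lt_left hM, fun X => ?_⟩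
  obtain ⟨h1, h2⟩ := h.etaForm_bounds hmM (dx X.1)
  rw [energyNorm_sq hβ, stateForm_apply, real_inner_self_eq_norm_sq X.2, zero_mul, zero_add,
    ← sq (val X.1 1)]
  set n := ‖dx X.1‖ ^ 2
  have hn : 0 ≤ n := sq_nonneg _
  have hr : 0 ≤ ‖X.2‖ ^ 2 + β * val X.1 1 ^ 2 := by positivity
  constructor
  · have h3 := mul_le_mul_of_nonneg_right (min_le_left m 1) hn
    have h4 := mul_le_mul_of_nonneg_right (min_le_right m 1) hr
    linarith
  · have h3 := mul_le_mul_of_nonneg_right (le_max_left M 1) hn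
    have h4 := mul_le_mul_of_nonneg_right (le_max_right M 1) hr
    linarith

lemma isMild_state_sub (h : CoeffHyp a b K) {Y₀ Z₀ : H1Zero a b × L2w a b}
    {y z : ℝ → H1Zero a b} (hy : IsMildSolution β Y₀ y) (hz : IsMildSolution β Z₀ z) :
    IsMild (h.waveGraph β) (Y₀ - Z₀) (fun t => state y t - state z t) :=
  (h.isMild_state hy).sub (h.isMild_state hz)

/-- The form with `κ = 0` is dissipative with rate zero and equivalent to the square of the energy
norm, by the bounds on `η`; hence no growth in time. -/
theorem exists_energyNorm_le (h : CoeffHyp a b K) (hβ : 0 ≤ β) :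
    ∃ C : ℝ, 0 ≤ C ∧ ∀ (Y₀ Z₀ : H1Zero a b × L2w a b) (y z : ℝ → H1Zero a b),
      IsMildSolution β Y₀ y → IsMildSolution β Z₀ z → ∀ t, 0 ≤ t →
        energyNorm β (state y t - state z t) ≤ C * energyNorm β (Y₀ - Z₀) := by
  obtain ⟨m, M, hm, hM, hmM⟩ := h.exists_energyNorm_bounds hβ
  refine ⟨Real.sqrt (M / m), Real.sqrt_nonneg _, fun Y₀ Z₀ y z hy hz t ht => ?_⟩
  have hX := h.isMild_state_sub hy hz
  have h1 := hX.apply_self_le (B' := h.stateForm 0 β) (ω' := 0) (h.stateForm_symm 0 β)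
    (fun p hp => by rw [zero_mul]; exact h.stateForm_zero_dissipative hp) ht
  rw [(h.isGenerator_waveGraph hβ).mild_zero hX, mul_zero, zero_mul, Real.exp_zero, one_mul] at h1
  have h2 := ((hmM _).1.trans h1).trans (hmM (Y₀ - Z₀)).2
  refine le_of_sq_le_sq ?_ (mul_nonneg (Real.sqrt_nonneg _) (Real.sqrt_nonneg _))
  rw [mul_pow, Real.sq_sqrt (by positivity), div_mul_eq_mul_div, le_div_iff₀ hm]
  linarith

/-- Here the coercive form with `κ = 1` is used; its rate `ω = 1/2` produces the factor `exp T`. -/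
theorem exists_norm_le (h : CoeffHyp a b K) (hβ : 0 ≤ β) (T : ℝ) :
    ∃ C : ℝ, ∀ (Y₀ Z₀ : H1Zero a b × L2w a b) (y z : ℝ → H1Zero a b),
      IsMildSolution β Y₀ y → IsMildSolution β Z₀ z → ∀ t ∈ Icc 0 T,
        ‖state y t - state z t‖ ≤ C * ‖Y₀ - Z₀‖ := by
  have hG := h.isGenerator_waveGraph hβ
  obtain ⟨m, hm, hc⟩ := hG.coercive
  obtain ⟨M, hM, hB⟩ := exists_apply_self_le (h.stateForm 1 β)
  refine ⟨Real.sqrt (Real.exp T * M / m), fun Y₀ Z₀ y z hy hz t ht => ?_⟩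
  have hX := h.isMild_state_sub hy hz
  have h1 := hX.apply_self_le hG.symm hG.dissipative ht.1
  rw [hG.mild_zero hX] at h1
  have h2 : Real.exp (2 * (1 / 2) * t) ≤ Real.exp T := Real.exp_le_exp.2 (by linarith [ht.2])
  have h4 := (hc _).trans (h1.trans
    (mul_le_mul h2 (hB (Y₀ - Z₀)) (hG.apply_self_nonneg _) (Real.exp_nonneg _)))
  refine le_of_sq_le_sq ?_ (mul_nonneg (Real.sqrt_nonneg _) (norm_nonneg _))
  rw [mul_pow, Real.sq_sqrt (by positivity), div_mul_eq_mul_div, le_div_iff₀ hm]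
  linarith

theorem exists_norm_le_energyNorm (h : CoeffHyp a b K) (hβ : 0 ≤ β) (hK : K ≤ 2) :
    ∃ C : ℝ, ∀ (Y₀ Z₀ : H1Zero a b × L2w a b) (y z : ℝ → H1Zero a b),
      IsMildSolution β Y₀ y → IsMildSolution β Z₀ z → ∀ t, 0 ≤ t →
        ‖state y t - state z t‖ ≤ C * energyNorm β (Y₀ - Z₀) := by
  obtain ⟨C, hC, hP⟩ := h.exists_poincare hK
  obtain ⟨C', hC', hE⟩ := h.exists_energyNorm_le hβ
  refine ⟨Real.sqrt (C + 1) * C', fun Y₀ Z₀ y z hy hz t ht => ?_⟩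
  set X := state y t - state z t
  have h1 : ‖X‖ ≤ Real.sqrt (C + 1) * energyNorm β X := by
    refine le_of_sq_le_sq ?_ (mul_nonneg (Real.sqrt_nonneg _) (Real.sqrt_nonneg _))
    rw [mul_pow, Real.sq_sqrt (by positivity), energyNorm_sq hβ, Prod.norm_def]
    have h2 := hP X.1
    have h3 := norm_sq_eq X.1
    have h4 : 0 ≤ (C + 1) * (β * val X.1 1 ^ 2) := by positivity
    have h5 : 0 ≤ C * ‖X.2‖ ^ 2 := by positivity
    have h6 : 0 ≤ (C + 1) * ‖dx X.1‖ ^ 2 := by positivity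
    rcases max_choice ‖X.1‖ ‖X.2‖ with h | h <;> rw [h] <;>
      nlinarith [sq_nonneg ‖X.2‖]
  calc ‖X‖ ≤ Real.sqrt (C + 1) * energyNorm β X := h1
    _ ≤ Real.sqrt (C + 1) * (C' * energyNorm β (Y₀ - Z₀)) :=
      mul_le_mul_of_nonneg_left (hE Y₀ Z₀ y z hy hz t ht) (Real.sqrt_nonneg _)
    _ = _ := by ring

/-- The equation in terms of the pointwise derivatives. -/
lemma exists_pointwise_of_hasOp (h : CoeffHyp a b K) {u : H1Zero a b} {f : L2w a b} {c : ℝ}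
    (hu : HasOp u f c) : ∃ p r : ℝ → ℝ, (∀ᵐ x ∂unitMeasure, dx u x = p x) ∧
      (∀ x ∈ Ioc (0 : ℝ) 1, IntervalIntegrable r volume x 1 ∧ p x = p 1 - ∫ s in x..1, r s) ∧
      (∀ᵐ x ∂unitMeasure, f x = a x * r x + b x * p x) ∧ eta a b 1 * p 1 = c := by
  set flux := fun x => c - ∫ s in x..1, f s / sigma a b s
  -- `p = flux / η`, and `r` is its derivative by the product rule. In `a r + b p` the terms
  -- containing `b` cancel, and `a / (σ η) = 1` leaves `f`.
  refine ⟨fun x => flux x * (eta a b x)⁻¹, fun x => f x / sigma a b x * (eta a b x)⁻¹ +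
    flux x * (-(b x / a x) * (eta a b x)⁻¹), ?_, fun x hx => ?_, ?_, ?_⟩
  · filter_upwards [hu] with x hx
    change _ = flux x at hx
    rw [← hx, mul_comm (eta a b x), mul_inv_cancel_right₀ (eta_pos x).ne']
  · have h1 := (h.isPrimitive_flux f c hx).mul (h.isPrimitive_eta_inv hx) hx.2
    exact ⟨h1.1, by rw [h1.integral_eq hx.2, sub_sub_cancel]⟩
  · filter_upwards [ae_restrict_mem measurableSet_Ioo] with x hx
    have h1 := (h.a_pos x (Ioo_subset_Ioc_self hx)).ne'
    have h2 := (eta_pos (a := a) (b := b) x).ne'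
    simp only [sigma]
    field_simp
    ring
  · have h2 := (eta_pos (a := a) (b := b) 1).ne'
    simp only [flux, intervalIntegral.integral_same, sub_zero]
    field_simp

/-- For data in the domain the state is differentiable with continuous derivative `V = 𝒜 (y, y_t)`.
Its components are `y_t` in `H¹` and `y_tt = A y` in `L²_{1/σ}`, and every clause is read off from
them. -/
theorem isClassicalSolution (h : CoeffHyp a b K) (hβ : 0 ≤ β) {Y₀ : H1Zero a b × L2w a b}
    (hY₀ : Y₀ ∈ waveDomain a b β) {y : ℝ → H1Zero a b} (hy : IsMildSolution β Y₀ y) :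
    IsClassicalSolution β y := by
  obtain ⟨W₀, hW₀⟩ := hY₀
  have hX := h.isMild_state hy
  obtain ⟨V, hVc, hV⟩ :=
    (h.isGenerator_waveGraph hβ).exists_hasDerivWithinAt (h.mem_waveGraph (p := (Y₀, W₀)).2 hW₀) hX
  have hop : ∀ t, 0 ≤ t → IsWaveOp β (state y t) (V t) := fun t ht => (hV t ht).1
  have hdy : ∀ t, 0 ≤ t → HasDerivWithinAt y (V t).1 (Ici 0) t := fun t ht =>
    (hV t ht).2.fst
  have hdv : ∀ t, 0 ≤ t → HasDerivWithinAt (velocity y) (V t).2 (Ici 0) t := fun t ht =>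
    (hV t ht).2.snd
  have hdL : ∀ t, 0 ≤ t → HasDerivWithinAt (fun s => toL2w (y s)) (velocity y t) (Ici 0) t :=
    fun t ht => h.hasDerivWithinAt_toL2w hX ht
  have hu : ∀ t, 0 ≤ t → UniqueDiffWithinAt ℝ (Ici (0 : ℝ)) t := fun t ht =>
    uniqueDiffOn_Ici 0 t ht
  have ey : ∀ t, 0 ≤ t → derivWithin y (Ici 0) t = (V t).1 := fun t ht =>
    (hdy t ht).derivWithin (hu t ht)
  have ev : ∀ t, 0 ≤ t → derivWithin (velocity y) (Ici 0) t = (V t).2 := fun t ht =>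
    (hdv t ht).derivWithin (hu t ht)
  refine ⟨?_, contDiffOn_one_Ici hdy hVc.fst, fun t ht => ?_,
    ⟨hX.continuousOn.fst, fun t => (V t).2, hVc.snd, fun t ht => ?_⟩, fun t ht => ?_,
    fun t ht => ?_⟩
  · have h1 := contDiffOn_succ_iff_derivWithin (𝕜 := ℝ) (f := fun t => toL2w (y t)) (n := 1)
      (uniqueDiffOn_Ici (0 : ℝ))
    rw [one_add_one_eq_two] at h1
    exact h1.2 ⟨fun t ht => (hdL t ht).differentiableWithinAt, by simp,
      contDiffOn_one_Ici hdv hVc.snd⟩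
  · rw [ey t ht]
    exact (hop t ht).1.symm
  · obtain ⟨-, c, hc, -⟩ := hop t ht
    exact ⟨c, hc⟩
  · obtain ⟨-, c, hc, hbc⟩ := hop t ht
    rw [ey t ht, ev t ht]
    exact ⟨c, hc, by rw [← hbc]; simp only [state]; ring⟩
  · obtain ⟨-, c, hc, hbc⟩ := hop t ht
    obtain ⟨p, r, h1, h2, h3, h4⟩ := h.exists_pointwise_of_hasOp hc
    rw [ey t ht, ev t ht]
    exact ⟨p, r, h1, h2, h3, by rw [h4, ← hbc]; simp only [state]; ring⟩

end CoeffHyp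

end

end DegenerateWave

theorem mainTheorem3 (a b : ℝ → ℝ) (K β : ℝ) (h : CoeffHyp a b K) (hβ : 0 ≤ β) :
    -- existence, uniqueness and regularity of the mild solution
    (∀ Y₀ : H1Zero a b × L2w a b,
      ∃ y : ℝ → H1Zero a b,
        IsMildSolution β Y₀ y ∧
        ContDiffOn ℝ 1 (fun t => toL2w (y t)) (Ici 0) ∧
        ContinuousOn y (Ici 0) ∧
        y 0 = Y₀.1 ∧ velocity y 0 = Y₀.2 ∧
        ∀ z : ℝ → H1Zero a b, IsMildSolution β Y₀ z →
          EqOn z y (Ici 0)) ∧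
    -- continuous dependence, in the norm of `ℋ₀`, uniformly in time
    (∃ C : ℝ, ∀ (Y₀ Z₀ : H1Zero a b × L2w a b)
      (y z : ℝ → H1Zero a b),
      IsMildSolution β Y₀ y → IsMildSolution β Z₀ z →
      ∀ t, 0 ≤ t →
        energyNorm β (state y t - state z t) ≤
          C * energyNorm β (Y₀ - Z₀)) ∧
    -- continuous dependence, in the norm of `H¹ × L²`, uniformly on bounded time intervals
    (∀ T : ℝ, ∃ C : ℝ, ∀ (Y₀ Z₀ : H1Zero a b × L2w a b)
      (y z : ℝ → H1Zero a b),
      IsMildSolution β Y₀ y → IsMildSolution β Z₀ z →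
      ∀ t ∈ Icc 0 T,
        ‖state y t - state z t‖ ≤ C * ‖Y₀ - Z₀‖) ∧
    -- if `K ≤ 2`, the norm of `ℋ₀` controls that of `H¹ × L²` too, uniformly in time
    (K ≤ 2 → ∃ C : ℝ, ∀ (Y₀ Z₀ : H1Zero a b × L2w a b)
      (y z : ℝ → H1Zero a b),
      IsMildSolution β Y₀ y → IsMildSolution β Z₀ z →
      ∀ t, 0 ≤ t →
        ‖state y t - state z t‖ ≤
          C * energyNorm β (Y₀ - Z₀)) ∧
    -- for data in the domain of `𝒜` the mild solution is classical
    (∀ Y₀ ∈ waveDomain a b β, ∀ y : ℝ → H1Zero a b,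
      IsMildSolution β Y₀ y → IsClassicalSolution β y) := by
  obtain ⟨C, -, hC⟩ := h.exists_energyNorm_le hβ
  exact ⟨h.exists_isMildSolution hβ, ⟨C, hC⟩, h.exists_norm_le hβ,
    h.exists_norm_le_energyNorm hβ, fun _ hY₀ _ hy => h.isClassicalSolution hβ hY₀ hy⟩
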